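/- Let $f$ be a transcendental (that is, non-rational) meromorphic function in $\mathbb{C}$ that solves the differential equation $P(z,f)=0$, where $$P(z,f)=\sum_{\lambda\in I}P_\lambda(z,f)=\sum_{\lambda=(i_0,\dots,i_m)\in I}a_\lambda\, f^{i_0}(f')^{i_1}\cdots(f^{(m)})^{i_m},$$ $m\ge 0$ is an integer, $I\subset\mathbb{Z}_{\ge 0}^{m+1}$ is a finite set of multi-indices, and the coefficients $a_\lambda$ are meromorphic in $\mathbb{C}$. For $\lambda=(i_0,\dots,i_m)$ put $|\lambda|=d(P_\lambda)=i_0+\cdots+i_m$ (degree) and $w(P_\lambda)=i_1+2i_2+\cdots+m\,i_m$ (weight). Suppose that $a_0:=P(z,0)\not\equiv 0$. Then there exists $r_0>0$ such that $$\begin{aligned} m\Big(r,\frac1f\Big)\le{}& \Big(\sum_{\lambda\in I}w(P_\lambda)\Big)\log^+\Big(\frac{T(\rho,f)}{r}\,\frac{\rho}{\rho-r}\Big)+\sum_{\lambda\in I,\ |\lambda|\ge1}m(r,a_\lambda)+m\Big(r,\frac1{a_0}\Big)\\ &+\sum_{\lambda\in I}d(P_\lambda)\log m!+\log^+\big(\mathrm{card}(I)-1\big)+5.3078\sum_{\lambda\in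 I}w(P_\lambda)\end{aligned}$$ for all $r_0<r<\rho<\infty$. Here $m(r,\cdot)$ and $T(r,\cdot)$ denote the Nevanlinna proximity function and characteristic function. -/

import Mathlib

namespace DiffPoly

/-- The differential polynomial
`P(z, f) = ∑_{λ ∈ I} a_λ(z) f(z)^{i_0} f'(z)^{i_1} ⋯ f^{(m)}(z)^{i_m}`, where `λ = (i_0, …, i_m)`
runs over the finite set `I` of multi-indices and `a_λ` is the coefficient function of `λ`. -/
noncomputable def eval {m : ℕ} (I : Finset (Fin (m + 1) → ℕ))
    (a : (Fin (m + 1) → ℕ) → ℂ → ℂ) (f : ℂ → ℂ) : ℂ → ℂ :=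
  fun z ↦ ∑ l ∈ I, a l z * ∏ j : Fin (m + 1), (iteratedDeriv (j : ℕ) f z) ^ l j

/-- The degree `i_0 + i_1 + ⋯ + i_m` of a multi-index `(i_0, …, i_m)`. -/
def degree {m : ℕ} (l : Fin (m + 1) → ℕ) : ℕ := ∑ j, l j

/-- The weight `i_1 + 2 i_2 + ⋯ + m i_m` of a multi-index `(i_0, …, i_m)`. -/
def weight {m : ℕ} (l : Fin (m + 1) → ℕ) : ℕ := ∑ j : Fin (m + 1), (j : ℕ) * l j

end DiffPoly

/-- A meromorphic function on the complex plane is transcendental if it is not a rational function.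
Meromorphic functions are identified when they agree outside a closed discrete set. -/
def IsTranscendentalMeromorphic (f : ℂ → ℂ) : Prop :=
  Meromorphic f ∧ ¬ ∃ p q : Polynomial ℂ, q ≠ 0 ∧
    f =ᶠ[Filter.codiscrete ℂ] fun z ↦ p.eval z / q.eval z

/-!
Dividing the equation `P(z, f) = 0` by `a₀ f` shows that, at points where `|f| < 1`,
`|1 / f| ≤ |1 / a₀| * ∑ |a_l| * ∏ |f⁽ʲ⁾ / f| ^ l_j`, the sum running over the multi-indices of degree
at least one (`DiffPoly.posLog_norm_inv_le`). Averaging `log⁺` of both sides over `|z| = r` reduces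
the theorem to the estimate
`m(r, f⁽ʲ⁾ / f) ≤ j * (log⁺ (T(ρ, f) / r * ρ / (ρ - r)) + 5.3078) + log j!`
(`exists_proximity_iteratedDeriv_div_le`), because `∑ l_j * j` is the weight and `∑ l_j` the degree.

For the estimate, call a function on the disk of radius `r` Carathéodory if its real part is
nonnegative, and its value at the origin its mass. Jensen's formula for `1 + h` gives exactly
`log (1 + M)` as the mean of `log |1 + h|`, and `|1 + h|² ≥ 1 + |h|²`; so whatever is dominated on the
circle by a fixed number of Carathéodory functions of total mass `B` has a logarithmic mean of at most
`log B` plus a constant (`circleAverage_log_one_add_le`). The logarithmic derivative `z g' / g` is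
dominated by seven such functions, of total mass at most
`4.1 * ρ / (ρ - r) * (T(ρ, g) + T(ρ, 1 / g))` (`exists_isCaratheodory_logDeriv`): the canonical
decomposition on a slightly larger disk splits `g` into a zero-free function, whose logarithmic
derivative is handled by a Herglotz integral, and canonical factors, whose logarithmic derivatives are
combinations of the kernels `1 / (1 - w z) - 1 / 2` and their conjugates.

Higher derivatives are treated by induction. With `κ = T(ρ, f) * ρ / (ρ - r)` and
`u_j = z ^ j f⁽ʲ⁾ / (κ ^ j f)`, the function `F = (1 + u_j) f` satisfies
`κ u_{j+1} = (u_j + 1) z F' / F - j u_j - z f' / f`. Hence the logarithmic mean of `u_{j+1}` exceeds that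
of `u_j` by at most `j / κ` and the logarithmic mean of two first-order logarithmic derivatives
(`circleAverage_eulerRatio_succ_le`). The poles of `F` have at most `j + 1` times the order of those of
`f`, and using `z ^ j f⁽ʲ⁾` instead of `f⁽ʲ⁾` keeps its behaviour at the origin comparable to that of
`f`, so `T(ρ', F)` and `T(ρ', 1 / F)` are at most `(j + 1) T(ρ, f) + O(1)`. The error terms disappear for
large radii because the characteristic of a nonconstant function is unbounded
(`tendsto_characteristic_atTop`).
-/

open Real Metric Set Filter Topology MeasureTheory Function MeromorphicOn ComplexConjugate
open ValueDistribution

/-! ### Circle averages -/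

lemma Real.circleAverage_mono_codiscreteWithin {f g : ℂ → ℝ} {c : ℂ} {r : ℝ} (hr : r ≠ 0)
    (hf : CircleIntegrable f c r) (hg : CircleIntegrable g c r)
    (h : f ≤ᶠ[codiscreteWithin (sphere c |r|)] g) :
    circleAverage f c r ≤ circleAverage g c r := by
  have heq : f =ᶠ[codiscreteWithin (sphere c |r|)] fun z ↦ min (f z) (g z) := by
    filter_upwards [h] with z hz
    exact (min_eq_left hz).symm
  rw [circleAverage_congr_codiscreteWithin heq hr]
  exact circleAverage_mono (hf.congr_codiscreteWithin heq) hg fun z _ ↦ min_le_right _ _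

lemma CircleIntegrable.of_measurable_of_le {g G : ℂ → ℝ} {c : ℂ} {r : ℝ} (hg : Measurable g)
    (hG : CircleIntegrable G c r) (h₀ : ∀ z, 0 ≤ g z) (h : ∀ z, g z ≤ G z) :
    CircleIntegrable g c r := by
  refine IntervalIntegrable.mono_fun hG ?_ ?_
  · exact (hg.comp (continuous_circleMap c r).measurable).aestronglyMeasurable
  · filter_upwards with θ
    rw [norm_of_nonneg (h₀ _)]
    exact (h _).trans (le_abs_self _)

lemma log_one_add_le_log_two_add_posLog {x : ℝ} (hx : 0 ≤ x) :
    log (1 + x) ≤ log 2 + log⁺ x := by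
  rw [posLog_eq_log_max_one hx, ← log_mul two_ne_zero (by positivity)]
  exact log_le_log (by positivity) (by linarith [le_max_left 1 x, le_max_right 1 x])

lemma posLog_le_log_one_add {x : ℝ} (hx : 0 ≤ x) : log⁺ x ≤ log (1 + x) := by
  rw [posLog_eq_log_max_one hx]
  exact log_le_log (by positivity) (max_le (by linarith) (by linarith))

lemma log_one_add_add_le {x y : ℝ} (hx : 0 ≤ x) (hy : 0 ≤ y) :
    log (1 + (x + y)) ≤ log (1 + x) + log (1 + y) := by
  rw [← log_mul (by positivity) (by positivity)]
  exact log_le_log (by positivity) (by nlinarith [mul_nonneg hx hy])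

lemma Meromorphic.circleIntegrable_log_one_add_norm {u : ℂ → ℂ} (hu : Meromorphic u) (r : ℝ) :
    CircleIntegrable (fun z ↦ log (1 + ‖u z‖)) 0 r := by
  have hm := hu.measurable
  refine CircleIntegrable.of_measurable_of_le (G := fun z ↦ log 2 + log⁺ ‖u z‖) (by fun_prop)
    ((circleIntegrable_const _ _ _).add hu.meromorphicOn.circleIntegrable_posLog_norm)
    (fun z ↦ log_nonneg (by linarith [norm_nonneg (u z)]))
    fun z ↦ log_one_add_le_log_two_add_posLog (norm_nonneg _)

lemma Meromorphic.circleIntegrable_log_one_add_norm_add_norm {u v : ℂ → ℂ} (hu : Meromorphic u)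
    (hv : Meromorphic v) (r : ℝ) :
    CircleIntegrable (fun z ↦ log (1 + (‖u z‖ + ‖v z‖))) 0 r := by
  have hm := hu.measurable
  have hm' := hv.measurable
  refine CircleIntegrable.of_measurable_of_le (G := fun z ↦ log (1 + ‖u z‖) + log (1 + ‖v z‖))
    (by fun_prop)
    ((hu.circleIntegrable_log_one_add_norm r).add (hv.circleIntegrable_log_one_add_norm r))
    (fun z ↦ log_nonneg (by linarith [norm_nonneg (u z), norm_nonneg (v z)]))
    fun z ↦ log_one_add_add_le (norm_nonneg _) (norm_nonneg _)

/-! ### Functions with nonnegative real part -/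

/-- `h` is meromorphic on the closed disk of radius `r` around `0`, analytic inside, has nonnegative
real part and takes the real value `M` at the origin. Poles on the circle are allowed. -/
structure IsCaratheodory (r : ℝ) (h : ℂ → ℂ) (M : ℝ) : Prop where
  meromorphicOn : MeromorphicOn h (closedBall 0 r)
  analyticOnNhd : AnalyticOnNhd ℂ h (ball 0 r)
  re_nonneg : ∀ z ∈ closedBall 0 r, 0 ≤ (h z).re
  apply_zero : h 0 = M

namespace IsCaratheodory

variable {r M : ℝ} {h : ℂ → ℂ}

lemma mass_nonneg (H : IsCaratheodory r h M) (hr : 0 < r) : 0 ≤ M := by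
  simpa [H.apply_zero] using H.re_nonneg 0 (by simp [hr.le])

lemma const_mul (H : IsCaratheodory r h M) {s : ℝ} (hs : 0 ≤ s) :
    IsCaratheodory r (fun z ↦ s * h z) (s * M) where
  meromorphicOn := (MeromorphicOn.const _).mul H.meromorphicOn
  analyticOnNhd := analyticOnNhd_const.mul H.analyticOnNhd
  re_nonneg z hz := by simpa using mul_nonneg hs (H.re_nonneg z hz)
  apply_zero := by simp [H.apply_zero]

lemma sum {ι : Type*} (s : Finset ι) {h : ι → ℂ → ℂ} {M : ι → ℝ}
    (H : ∀ i ∈ s, IsCaratheodory r (h i) (M i)) :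
    IsCaratheodory r (fun z ↦ ∑ i ∈ s, h i z) (∑ i ∈ s, M i) where
  meromorphicOn := fun z hz ↦ MeromorphicAt.fun_sum fun i hi ↦ (H i hi).meromorphicOn z hz
  analyticOnNhd := fun z hz ↦ Finset.analyticAt_fun_sum _ fun i hi ↦ (H i hi).analyticOnNhd z hz
  re_nonneg z hz := by
    rw [Complex.re_sum]
    exact Finset.sum_nonneg fun i hi ↦ (H i hi).re_nonneg z hz
  apply_zero := by
    push_cast
    exact Finset.sum_congr rfl fun i hi ↦ (H i hi).apply_zero

/-- Jensen's formula for `1 + h`, which has no zeros and no poles inside the disk. -/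
lemma circleAverage_log_norm_one_add (H : IsCaratheodory r h M) (hr : 0 < r) :
    circleAverage (fun z ↦ log ‖1 + h z‖) 0 r = log (1 + M) := by
  have hM := H.mass_nonneg hr
  have hmer : MeromorphicOn (fun z ↦ 1 + h z) (closedBall 0 |r|) := by
    rw [abs_of_pos hr]
    exact (MeromorphicOn.const 1).add H.meromorphicOn
  have han : ∀ z ∈ ball 0 r, AnalyticAt ℂ (fun z ↦ 1 + h z) z := fun z hz ↦
    analyticAt_const.add (H.analyticOnNhd z hz)
  have hne : ∀ z ∈ ball 0 r, 1 + h z ≠ 0 := by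
    intro z hz h0
    have := congrArg Complex.re h0
    simp only [Complex.add_re, Complex.one_re, Complex.zero_re] at this
    linarith [H.re_nonneg z (ball_subset_closedBall hz)]
  have hdiv : ∀ z ∈ ball 0 r, divisor (fun z ↦ 1 + h z) (closedBall 0 |r|) z = 0 := by
    intro z hz
    have hz' : z ∈ closedBall 0 |r| := by
      rw [abs_of_pos hr]; exact ball_subset_closedBall hz
    rw [divisor_apply hmer hz',
      (han z hz).meromorphicNFAt.meromorphicOrderAt_eq_zero_iff.2 (hne z hz)]
    rfl
  have h0 : (0 : ℂ) ∈ ball 0 r := by simp [hr]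
  rw [MeromorphicOn.circleAverage_log_norm hr.ne' hmer, hdiv 0 h0,
    (han 0 h0).meromorphicTrailingCoeffAt_of_ne_zero (hne 0 h0), H.apply_zero,
    finsum_eq_zero_of_forall_eq_zero]
  · have : (1 + (M : ℂ)) = ((1 + M : ℝ) : ℂ) := by push_cast; rfl
    rw [this, Complex.norm_real, norm_of_nonneg (by positivity)]
    simp
  · intro z
    by_cases hz : z ∈ ball 0 r
    · simp [hdiv z hz]
    by_cases hz' : z ∈ closedBall 0 r
    · have : ‖z‖ = r := by
        simp only [mem_ball, dist_zero_right, mem_closedBall] at hz hz'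
        linarith
      simp [this, hr.ne']
    · rw [Function.locallyFinsuppWithin.apply_eq_zero_of_notMem _ (by rwa [abs_of_pos hr])]
      simp

lemma one_add_sq_norm_le (H : IsCaratheodory r h M) {z : ℂ} (hz : z ∈ closedBall 0 r) :
    1 + ‖h z‖ ^ 2 ≤ ‖1 + h z‖ ^ 2 := by
  rw [← Complex.normSq_eq_norm_sq, ← Complex.normSq_eq_norm_sq, Complex.normSq_add]
  have := H.re_nonneg z hz
  simp
  linarith

end IsCaratheodory

lemma Finset.one_add_sum_sq_le_prod {ι : Type*} (s : Finset ι) (x : ι → ℝ) :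
    1 + ∑ i ∈ s, x i ^ 2 ≤ ∏ i ∈ s, (1 + x i ^ 2) := by
  classical
  induction s using Finset.induction_on with
  | empty => simp
  | insert a s ha ih =>
    rw [Finset.sum_insert ha, Finset.prod_insert ha]
    nlinarith [sq_nonneg (x a), Finset.sum_nonneg fun i (_ : i ∈ s) ↦ sq_nonneg (x i)]

/-- Since `1 + h i` has at least the modulus `√(1 + ‖h i‖²)`, the Cauchy-Schwarz inequality bounds a
sum of moduli by a product of the zero-free functions `1 + h i`. This is what makes Jensen's formula
applicable. -/
lemma log_one_add_sum_norm_le {ι : Type*} [Fintype ι] {r : ℝ} {h : ι → ℂ → ℂ} {M : ι → ℝ}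
    (H : ∀ i, IsCaratheodory r (h i) (M i)) {z : ℂ} (hz : z ∈ closedBall 0 r) :
    log (1 + ∑ i, ‖h i z‖) ≤ 2⁻¹ * log (Fintype.card ι + 1) + ∑ i, log ‖1 + h i z‖ := by
  have hpos : ∀ i, 0 < ‖1 + h i z‖ := by
    intro i
    have := (H i).one_add_sq_norm_le hz
    by_contra hcon
    have : ‖1 + h i z‖ = 0 := le_antisymm (not_lt.1 hcon) (norm_nonneg _)
    nlinarith [sq_nonneg ‖h i z‖]
  have hcs : (1 + ∑ i, ‖h i z‖) ^ 2 ≤ (Fintype.card ι + 1) * (1 + ∑ i, ‖h i z‖ ^ 2) := by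
    have h1 : (∑ i, ‖h i z‖) ^ 2 ≤ Fintype.card ι * ∑ i, ‖h i z‖ ^ 2 := by
      simpa using sq_sum_le_card_mul_sum_sq (s := Finset.univ) (f := fun i ↦ ‖h i z‖)
    set S := ∑ i, ‖h i z‖
    set Q := ∑ i, ‖h i z‖ ^ 2
    set n : ℝ := (Fintype.card ι : ℝ)
    have hn : (0 : ℝ) ≤ n := Nat.cast_nonneg _
    have hQ : 0 ≤ Q := Finset.sum_nonneg fun i _ ↦ sq_nonneg _
    -- `2 S ≤ n + Q` because `S² ≤ n Q` and `4 n Q ≤ (n + Q)²`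
    have h2 : 2 * S ≤ n + Q := by
      refine abs_le_of_sq_le_sq' (a := 2 * S) (b := n + Q) ?_ (by positivity) |>.2
      nlinarith [sq_nonneg (n - Q)]
    nlinarith
  have hprod : (1 + ∑ i, ‖h i z‖) ^ 2 ≤ (Fintype.card ι + 1) * (∏ i, ‖1 + h i z‖) ^ 2 := by
    refine hcs.trans ?_
    gcongr
    refine (Finset.one_add_sum_sq_le_prod _ _).trans ?_
    rw [← Finset.prod_pow]
    exact Finset.prod_le_prod (fun i _ ↦ by positivity) fun i _ ↦ (H i).one_add_sq_norm_le hz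
  have hS : 0 < 1 + ∑ i, ‖h i z‖ := by positivity
  have hP : 0 < ∏ i, ‖1 + h i z‖ := Finset.prod_pos fun i _ ↦ hpos i
  have := log_le_log (by positivity) hprod
  rw [log_pow, log_mul (by positivity) (by positivity), log_pow,
    log_prod fun i _ ↦ (hpos i).ne'] at this
  push_cast at this
  linarith

/-- A function dominated on the circle of radius `r` by finitely many Carathéodory functions of total
mass at most `B` has a logarithmic mean bounded by `log B` plus a constant. -/
theorem circleAverage_log_one_add_le {ι : Type*} [Fintype ι] {r : ℝ} (hr : 0 < r)
    {h : ι → ℂ → ℂ} {M : ι → ℝ} (H : ∀ i, IsCaratheodory r (h i) (M i)) {Y : ℂ → ℝ} {B : ℝ}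
    (hB : 1 ≤ B) (hMB : ∑ i, M i ≤ B) (hY₀ : ∀ z, 0 ≤ Y z)
    (hYi : CircleIntegrable (fun z ↦ log (1 + Y z)) 0 r)
    (hY : ∀ᶠ z in codiscreteWithin (sphere 0 r), Y z ≤ ∑ i, ‖h i z‖) :
    circleAverage (fun z ↦ log (1 + Y z)) 0 r
      ≤ log B + 2⁻¹ * log (Fintype.card ι + 1) + 1 := by
  have hB₀ : 0 < B := by linarith
  -- rescaling by `B` makes the total mass at most `1`
  have H' : ∀ i, IsCaratheodory r (fun z ↦ (B⁻¹ : ℝ) * h i z) (B⁻¹ * M i) := fun i ↦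
    (H i).const_mul (inv_nonneg.2 hB₀.le)
  have hint : ∀ i, CircleIntegrable (fun z ↦ log ‖1 + (B⁻¹ : ℝ) * h i z‖) 0 r := fun i ↦ by
    apply MeromorphicOn.circleIntegrable_log_norm
    rw [abs_of_pos hr]
    exact (MeromorphicOn.const 1).add ((H' i).meromorphicOn.mono_set sphere_subset_closedBall)
  have hint' : CircleIntegrable (fun z ↦ ∑ i, log ‖1 + (B⁻¹ : ℝ) * h i z‖) 0 r :=
    CircleIntegrable.fun_sum _ fun i _ ↦ hint i
  calc circleAverage (fun z ↦ log (1 + Y z)) 0 r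
      ≤ circleAverage (fun z ↦ (log B + 2⁻¹ * log (Fintype.card ι + 1))
          + ∑ i, log ‖1 + (B⁻¹ : ℝ) * h i z‖) 0 r := by
        refine circleAverage_mono_codiscreteWithin hr.ne' hYi
          ((circleIntegrable_const _ _ _).add hint') ?_
        rw [abs_of_pos hr]
        filter_upwards [hY, self_mem_codiscreteWithin _] with z hz hzr
        have h1 := log_one_add_sum_norm_le H' (sphere_subset_closedBall hzr)
        have h2 : 1 + Y z ≤ B * (1 + ∑ i, ‖(B⁻¹ : ℝ) * h i z‖) := by
          simp only [norm_mul, Complex.norm_real, norm_of_nonneg (inv_nonneg.2 hB₀.le)]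
          rw [← Finset.mul_sum, mul_add, mul_inv_cancel_left₀ hB₀.ne', mul_one]
          linarith
        have h3 := log_le_log (by linarith [hY₀ z]) h2
        rw [log_mul hB₀.ne' (by positivity)] at h3
        linarith
    _ = log B + 2⁻¹ * log (Fintype.card ι + 1) + ∑ i, log (1 + B⁻¹ * M i) := by
        rw [circleAverage_fun_add (circleIntegrable_const _ _ _) hint', circleAverage_const,
          circleAverage_fun_sum fun i _ ↦ hint i]
        simp_rw [fun i ↦ (H' i).circleAverage_log_norm_one_add hr]
    _ ≤ log B + 2⁻¹ * log (Fintype.card ι + 1) + 1 := by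
        gcongr
        calc ∑ i, log (1 + B⁻¹ * M i) ≤ ∑ i, B⁻¹ * M i := by
              refine Finset.sum_le_sum fun i _ ↦ ?_
              have h0 : 0 ≤ B⁻¹ * M i :=
                mul_nonneg (inv_nonneg.2 hB₀.le) ((H i).mass_nonneg hr)
              linarith [log_le_sub_one_of_pos (show 0 < 1 + B⁻¹ * M i by linarith)]
          _ ≤ 1 := by
              rw [← Finset.mul_sum, inv_mul_le_iff₀ hB₀, mul_one]
              exact hMB

/-! ### Elementary kernels -/

/-- The function `z ↦ 1 / (1 - w z) - 1 / 2`, written so that it takes the value `0` at its pole. For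
`w ≠ 0` it maps the disk `‖w * z‖ < 1` onto the right half-plane. -/
noncomputable def halfPlaneKernel (w z : ℂ) : ℂ := (1 + w * z) / (2 * (1 - w * z))

lemma isCaratheodory_halfPlaneKernel {r : ℝ} {w : ℂ} (hw : ‖w‖ * r ≤ 1) :
    IsCaratheodory r (halfPlaneKernel w) 2⁻¹ where
  meromorphicOn z _ := by unfold halfPlaneKernel; fun_prop
  analyticOnNhd z hz := by
    have hz' : ‖z‖ < r := by simpa using hz
    have : (1 : ℂ) - w * z ≠ 0 := by
      intro h0
      have h1 : ‖w * z‖ = 1 := by rw [← sub_eq_zero.1 h0, norm_one]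
      rw [norm_mul] at h1
      by_cases hw0 : ‖w‖ = 0
      · simp [hw0] at h1
      · have : 0 < ‖w‖ := lt_of_le_of_ne (norm_nonneg _) (Ne.symm hw0)
        nlinarith
    have h2 : (2 : ℂ) * (1 - w * z) ≠ 0 := mul_ne_zero two_ne_zero this
    unfold halfPlaneKernel
    fun_prop (disch := assumption)
  re_nonneg z hz := by
    have hz' : ‖z‖ ≤ r := by simpa using hz
    have h1 : ‖w * z‖ ≤ 1 := by
      rw [norm_mul]
      exact (mul_le_mul_of_nonneg_left hz' (norm_nonneg _)).trans hw
    have h2 : Complex.normSq (w * z) ≤ 1 := by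
      rw [Complex.normSq_eq_norm_sq]
      nlinarith [norm_nonneg (w * z)]
    rw [halfPlaneKernel, Complex.div_re, ← add_div]
    apply div_nonneg _ (Complex.normSq_nonneg _)
    set u := w * z
    rw [Complex.normSq_apply] at h2
    simp
    nlinarith
  apply_zero := by simp [halfPlaneKernel]

lemma halfPlaneKernel_eq {w z : ℂ} (h : 1 - w * z ≠ 0) :
    halfPlaneKernel w z = 1 / (1 - w * z) - 1 / 2 := by
  unfold halfPlaneKernel
  field_simp
  ring

/-! ### Logarithmic derivatives of zero-free functions -/

lemma norm_circleAverage_le {f : ℂ → ℂ} {c : ℂ} {R : ℝ} :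
    ‖circleAverage f c R‖ ≤ circleAverage (fun z ↦ ‖f z‖) c R := by
  rw [circleAverage, circleAverage, norm_smul, norm_of_nonneg (by positivity), smul_eq_mul]
  gcongr
  exact intervalIntegral.norm_integral_le_integral_norm two_pi_pos.le

/-- The Herglotz integral of a real-valued function on the circle of radius `R`. -/
noncomputable def herglotzIntegral (R : ℝ) (L : ℂ → ℝ) (z : ℂ) : ℂ :=
  circleAverage (fun ζ ↦ herglotzRieszKernel 0 z ζ • (L ζ : ℂ)) 0 R

section Herglotz

variable {R : ℝ} {L : ℂ → ℝ} {z : ℂ}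

lemma CircleIntegrable.complex_ofReal {c : ℂ} (hL : CircleIntegrable L c R) :
    CircleIntegrable (fun ζ ↦ (L ζ : ℂ)) c R := by
  simp only [CircleIntegrable, intervalIntegrable_iff] at hL ⊢
  exact Complex.ofRealCLM.integrable_comp hL

lemma re_herglotzIntegral (hL : CircleIntegrable L 0 R) (hz : z ∈ ball 0 R) :
    (herglotzIntegral R L z).re = circleAverage (fun ζ ↦ poissonKernel 0 z ζ * L ζ) 0 R := by
  rw [herglotzIntegral, re_circleAverage_herglotzRieszKernel_smul hL hz,
    poissonKernel_eq_re_herglotzRieszKernel]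
  rfl

lemma analyticOnNhd_herglotzIntegral (hL : CircleIntegrable L 0 R) :
    AnalyticOnNhd ℂ (herglotzIntegral R L) (ball 0 R) :=
  analyticOnNhd_circleAverage_herglotzRieszKernel_smul hL.complex_ofReal

lemma herglotzIntegral_zero (hR : 0 < R) (hL : CircleIntegrable L 0 R) :
    herglotzIntegral R L 0 = (circleAverage L 0 R : ℝ) := by
  have h := Complex.ofRealCLM.circleAverage_comp_comm hL
  rw [herglotzIntegral, ← Complex.ofRealCLM_apply, ← h]
  refine circleAverage_congr_sphere fun ζ hζ ↦ ?_
  have hζ' : ζ ≠ 0 := by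
    rintro rfl
    simp only [mem_sphere, dist_self] at hζ
    exact (abs_pos.2 hR.ne').ne hζ
  simp [herglotzRieszKernel_def, hζ']

lemma poissonKernel_nonneg {ζ : ℂ} (hz : z ∈ ball 0 R) (hζ : ζ ∈ sphere 0 R) :
    0 ≤ poissonKernel 0 z ζ := by
  have h1 : ‖z‖ < R := by simpa using hz
  have h2 : ‖ζ‖ = R := by simpa using hζ
  simp only [poissonKernel_def, sub_zero, h2]
  apply div_nonneg _ (by positivity)
  nlinarith [norm_nonneg z]

lemma norm_deriv_herglotzRieszKernel {ζ : ℂ} (hz : z ∈ ball 0 R) (hζ : ζ ∈ sphere 0 R) :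
    ‖2 * ζ / (ζ - z) ^ 2‖ = 2 * R / (R ^ 2 - ‖z‖ ^ 2) * poissonKernel 0 z ζ := by
  have h1 : ‖z‖ < R := by simpa using hz
  have h2 : ‖ζ‖ = R := by simpa using hζ
  have h3 : R ^ 2 - ‖z‖ ^ 2 ≠ 0 := by nlinarith [norm_nonneg z]
  simp only [poissonKernel_def, sub_zero, h2, norm_div, norm_mul, norm_pow, Complex.norm_ofNat]
  field_simp

/-- The logarithmic derivative of a zero-free function is the derivative of the Herglotz integral of
its logarithmic modulus; the kernel of that derivative is a multiple of the Poisson kernel. -/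
theorem norm_logDeriv_le_re_herglotzIntegral {h : ℂ → ℂ} (h₁ : AnalyticOnNhd ℂ h (closedBall 0 R))
    (h₂ : ∀ z ∈ closedBall 0 R, h z ≠ 0) (hz : z ∈ ball 0 R) :
    ‖logDeriv h z‖ ≤ 2 * R / (R ^ 2 - ‖z‖ ^ 2)
      * (herglotzIntegral R (fun ζ ↦ |log ‖h ζ‖|) z).re := by
  have hR : 0 < R := pos_of_mem_ball hz
  set L : ℂ → ℝ := fun ζ ↦ log ‖h ζ‖ with hLdef
  have hLi : CircleIntegrable L 0 R := MeromorphicOn.circleIntegrable_log_norm (by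
    rw [abs_of_pos hR]
    exact fun w hw ↦ (h₁ w (sphere_subset_closedBall hw)).meromorphicAt)
  set ψ := herglotzIntegral R L with hψ
  have hψre : ∀ w ∈ ball 0 R, (ψ w).re = L w := by
    intro w hw
    rw [hψ, herglotzIntegral, re_circleAverage_herglotzRieszKernel_smul hLi hw]
    exact InnerProductSpace.HarmonicOnNhd.circleAverage_re_herglotzRieszKernel_smul
      (fun x hx ↦ (h₁ x hx).harmonicAt_log_norm (h₂ x hx)) hw
  have hψd : ∀ w ∈ ball 0 R, HasDerivAt ψ
      (circleAverage (fun ζ ↦ (2 * ζ / (ζ - w) ^ 2) • (L ζ : ℂ)) 0 R) w := fun w hw ↦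
    hasDerivAt_circleAverage_herglotzRieszKernel_smul hLi.complex_ofReal hw
  have hnorm : ∀ w ∈ ball 0 R, ‖h w * Complex.exp (-ψ w)‖ = 1 := by
    intro w hw
    rw [norm_mul, Complex.norm_exp, Complex.neg_re, hψre w hw, Real.exp_neg, hLdef,
      Real.exp_log (norm_pos_iff.2 (h₂ w (ball_subset_closedBall hw)))]
    exact mul_inv_cancel₀ (norm_ne_zero_iff.2 (h₂ w (ball_subset_closedBall hw)))
  have hnhds : ∀ᶠ w in 𝓝 z, w ∈ ball 0 R := isOpen_ball.mem_nhds hz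
  -- a function of constant modulus is locally constant
  have hconst : (fun w ↦ h w * Complex.exp (-ψ w)) =ᶠ[𝓝 z]
      fun _ ↦ h z * Complex.exp (-ψ z) := by
    apply Complex.eventually_eq_of_isLocalMax_norm
    · filter_upwards [hnhds] with w hw
      exact (h₁ w (ball_subset_closedBall hw)).differentiableAt.mul
        (hψd w hw).differentiableAt.neg.cexp
    · filter_upwards [hnhds] with w hw
      simp only [comp_apply]
      rw [hnorm w hw, hnorm z hz]
  have hlog : logDeriv h z = circleAverage (fun ζ ↦ (2 * ζ / (ζ - z) ^ 2) • (L ζ : ℂ)) 0 R := by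
    have hd := ((h₁ z (ball_subset_closedBall hz)).differentiableAt.hasDerivAt).mul
      (hψd z hz).neg.cexp
    have h0 := hd.unique ((hasDerivAt_const z _).congr_of_eventuallyEq hconst)
    have hne := h₂ z (ball_subset_closedBall hz)
    have hexp := Complex.exp_ne_zero (-ψ z)
    rw [logDeriv_apply, div_eq_iff hne]
    apply mul_right_cancel₀ hexp
    simp only [Pi.neg_apply] at h0
    linear_combination h0
  have hre := re_herglotzIntegral (L := fun ζ ↦ |log ‖h ζ‖|) hLi.abs hz
  rw [hre, hlog, ← smul_eq_mul, ← circleAverage_fun_smul]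
  refine norm_circleAverage_le.trans (le_of_eq (circleAverage_congr_sphere fun ζ hζ ↦ ?_))
  rw [abs_of_pos hR] at hζ
  simp only [smul_eq_mul]
  rw [norm_mul, Complex.norm_real, norm_eq_abs, norm_deriv_herglotzRieszKernel hz hζ]
  ring

lemma isCaratheodory_herglotzIntegral {r : ℝ} (hr : 0 < r) (hrR : r < R)
    (hL : CircleIntegrable L 0 R) (hL₀ : ∀ z, 0 ≤ L z) :
    IsCaratheodory r (herglotzIntegral R L) (circleAverage L 0 R) where
  meromorphicOn := ((analyticOnNhd_herglotzIntegral hL).mono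
    (closedBall_subset_ball hrR)).meromorphicOn
  analyticOnNhd := (analyticOnNhd_herglotzIntegral hL).mono (ball_subset_ball hrR.le)
  re_nonneg z hz := by
    rw [re_herglotzIntegral hL (closedBall_subset_ball hrR hz)]
    refine circleAverage_nonneg_of_nonneg fun ζ hζ ↦ mul_nonneg ?_ (hL₀ ζ)
    rw [abs_of_pos (hr.trans hrR)] at hζ
    exact poissonKernel_nonneg (closedBall_subset_ball hrR hz) hζ
  apply_zero := herglotzIntegral_zero (hr.trans hrR) hL

end Herglotz

/-- The function `z h'(z) / h(z)` of a zero-free `h` is dominated on the circle of radius `r` by a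
Carathéodory function. -/
theorem exists_isCaratheodory_of_ne_zero {r R : ℝ} (hr : 0 < r) (hrR : r < R) {h : ℂ → ℂ}
    (h₁ : AnalyticOnNhd ℂ h (closedBall 0 R)) (h₂ : ∀ z ∈ closedBall 0 R, h z ≠ 0) :
    ∃ G, IsCaratheodory r G
        (2 * R * r / (R ^ 2 - r ^ 2) * circleAverage (fun ζ ↦ |log ‖h ζ‖|) 0 R) ∧
      ∀ z ∈ sphere 0 r, ‖z * logDeriv h z‖ ≤ ‖G z‖ := by
  have hR : 0 < R := hr.trans hrR
  have hd : 0 < R ^ 2 - r ^ 2 := by nlinarith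
  have hLi : CircleIntegrable (fun ζ ↦ log ‖h ζ‖) 0 R :=
    MeromorphicOn.circleIntegrable_log_norm (by
      rw [abs_of_pos hR]
      exact fun w hw ↦ (h₁ w (sphere_subset_closedBall hw)).meromorphicAt)
  refine ⟨_, (isCaratheodory_herglotzIntegral hr hrR hLi.abs fun z ↦ abs_nonneg _).const_mul
    (s := 2 * R * r / (R ^ 2 - r ^ 2)) (by positivity), fun z hz ↦ ?_⟩
  have hzr : ‖z‖ = r := by simpa using hz
  have hzR : z ∈ ball 0 R := by simpa [hzr] using hrR
  have key := norm_logDeriv_le_re_herglotzIntegral h₁ h₂ hzR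
  rw [norm_mul, hzr, norm_mul, Complex.norm_real, norm_of_nonneg (by positivity)]
  rw [hzr] at key
  calc r * ‖logDeriv h z‖ ≤ r * (2 * R / (R ^ 2 - r ^ 2)
        * (herglotzIntegral R (fun ζ ↦ |log ‖h ζ‖|) z).re) := by gcongr
    _ = 2 * R * r / (R ^ 2 - r ^ 2) * (herglotzIntegral R (fun ζ ↦ |log ‖h ζ‖|) z).re := by ring
    _ ≤ _ := by
      gcongr
      exact (le_abs_self _).trans (Complex.abs_re_le_norm _)

/-! ### The logarithmic derivative of a meromorphic function -/

/-- The contribution to the logarithmic derivative of a zero `a` of modulus at most `r`. On the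
circle `‖z‖ = r` the term with its pole at `a` is the conjugate of a function regular in the disk. -/
lemma halfPlaneKernel_reflection {r R : ℝ} {a z : ℂ} (hr : 0 < r) (hz : ‖z‖ = r) (hza : z ≠ a)
    (haR : (R : ℂ) ^ 2 - conj a * z ≠ 0) (hR : R ≠ 0) :
    z / (z - a) + conj a * z / (R ^ 2 - conj a * z)
      = conj (halfPlaneKernel (conj a / r ^ 2) z) + halfPlaneKernel (conj a / R ^ 2) z := by
  have hRc : (R : ℂ) ≠ 0 := by exact_mod_cast hR
  have hrc : (r : ℂ) ≠ 0 := by exact_mod_cast hr.ne'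
  have hzz : z * conj z = (r : ℂ) ^ 2 := by
    rw [Complex.mul_conj, Complex.normSq_eq_norm_sq, hz]; push_cast; rfl
  have hz0 : z ≠ 0 := by rintro rfl; simp at hz; exact hr.ne hz
  have hzc : conj z ≠ 0 := by simpa using hz0
  have hza' : z - a ≠ 0 := sub_ne_zero.2 hza
  have h1 : 1 - conj a / (R : ℂ) ^ 2 * z ≠ 0 := by
    intro h
    apply haR
    field_simp at h
    linear_combination h
  have h2 : 1 - conj a / (r : ℂ) ^ 2 * z ≠ 0 := by
    intro h
    apply hza'
    rw [← hzz] at h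
    field_simp at h
    have h' := congrArg conj h
    simp at h'
    exact h'
  rw [halfPlaneKernel_eq h1, halfPlaneKernel_eq h2]
  have h3 : conj (1 / (1 - conj a / (r : ℂ) ^ 2 * z) - 1 / 2) = z / (z - a) - 1 / 2 := by
    simp only [map_sub, map_div₀, map_one, map_mul, map_pow, Complex.conj_conj, Complex.conj_ofReal,
      map_ofNat]
    congr 1
    rw [← hzz]
    field_simp
  have h4 : conj a * z / (R ^ 2 - conj a * z) = 1 / (1 - conj a / (R : ℂ) ^ 2 * z) - 1 := by
    have h5 : 1 - conj a / (R : ℂ) ^ 2 * z = (R ^ 2 - conj a * z) / R ^ 2 := by field_simp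
    rw [h5]
    field_simp
    ring
  rw [h3, h4]
  ring

/-- The contribution to the logarithmic derivative of a zero `a` outside the disk of radius `r`. -/
lemma halfPlaneKernel_outside {R : ℝ} {a z : ℂ} (ha : a ≠ 0) (hza : z ≠ a)
    (haR : (R : ℂ) ^ 2 - conj a * z ≠ 0) (hR : R ≠ 0) :
    z / (z - a) + conj a * z / (R ^ 2 - conj a * z)
      = -halfPlaneKernel a⁻¹ z + halfPlaneKernel (conj a / R ^ 2) z := by
  have hRc : (R : ℂ) ≠ 0 := by exact_mod_cast hR
  have hza' : z - a ≠ 0 := sub_ne_zero.2 hza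
  have hza'' : a - z ≠ 0 := sub_ne_zero.2 hza.symm
  have h1 : 1 - conj a / (R : ℂ) ^ 2 * z ≠ 0 := by
    intro h
    apply haR
    field_simp at h
    linear_combination h
  have h2 : 1 - a⁻¹ * z = (a - z) / a := by field_simp
  have h3 : 1 - a⁻¹ * z ≠ 0 := by rw [h2]; exact div_ne_zero hza'' ha
  rw [halfPlaneKernel_eq h1, halfPlaneKernel_eq h3, h2]
  have h4 : conj a * z / (R ^ 2 - conj a * z) = 1 / (1 - conj a / (R : ℂ) ^ 2 * z) - 1 := by
    have h5 : 1 - conj a / (R : ℂ) ^ 2 * z = (R ^ 2 - conj a * z) / R ^ 2 := by field_simp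
    rw [h5]
    field_simp
    ring
  have h5 : z / (z - a) = 1 - 1 / ((a - z) / a) := by
    field_simp
    ring
  rw [h4, h5]
  ring

lemma mul_logDeriv_canonicalFactor {R : ℝ} {a z : ℂ} (hR : R ≠ 0) (hza : z ≠ a)
    (haR : (R : ℂ) ^ 2 - conj a * z ≠ 0) :
    z * logDeriv (Complex.canonicalFactor R a) z
      = -(z / (z - a) + conj a * z / (R ^ 2 - conj a * z)) := by
  have hRc : (R : ℂ) ≠ 0 := by exact_mod_cast hR
  have hza' : z - a ≠ 0 := sub_ne_zero.2 hza
  have hden : (R : ℂ) * (z - a) ≠ 0 := mul_ne_zero hRc hza'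
  have h1 : HasDerivAt (fun z ↦ (R : ℂ) ^ 2 - conj a * z) (-conj a) z := by
    simpa using ((hasDerivAt_id z).const_mul (conj a)).const_sub ((R : ℂ) ^ 2)
  have h2 : HasDerivAt (fun z ↦ (R : ℂ) * (z - a)) R z := by
    simpa using ((hasDerivAt_id z).sub_const a).const_mul (R : ℂ)
  rw [Complex.canonicalFactor_def, logDeriv_div z haR hden h1.differentiableAt h2.differentiableAt,
    logDeriv_apply, logDeriv_apply, h1.deriv, h2.deriv]
  field_simp
  ring

/-- The number of points of an effective divisor in a smaller disk is controlled by the logarithmic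
counting function. The bound `3 ≤ ρ` makes `log ρ ≥ 1`, which serves the point at the origin. -/
lemma sum_le_logCounting {D : locallyFinsupp ℂ ℤ} (hD : 0 ≤ D) {R ρ : ℝ} (hR : R < ρ)
    (hρ : 3 ≤ ρ) (S : Finset ℂ) (hS : ∀ a ∈ S, ‖a‖ < R) :
    ∑ a ∈ S, (D a : ℝ) ≤ ρ / (ρ - R) * locallyFinsuppWithin.logCounting D ρ := by
  classical
  have hρ0 : 0 < ρ := by linarith
  have hD' : ∀ a, (0 : ℝ) ≤ D a := fun a ↦ by exact_mod_cast hD a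
  have hlog : 1 ≤ log ρ := by
    rw [le_log_iff_exp_le hρ0]
    exact (exp_one_lt_d9.le.trans (by norm_num)).trans hρ
  set E := D.toClosedBall ρ
  have hEfin : E.support.Finite := E.finiteSupport (isCompact_closedBall _ _)
  have hE : ∀ a, ‖a‖ ≤ ρ → E a = D a := fun a ha ↦
    locallyFinsuppWithin.toClosedBall_eval_within D (by simpa [abs_of_pos hρ0] using ha)
  have hterm : ∀ a, 0 ≤ E a * log (ρ * ‖a‖⁻¹) := by
    intro a
    by_cases ha : ‖a‖ ≤ ρ
    · rw [hE a ha]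
      apply mul_nonneg (hD' a)
      by_cases h0 : ‖a‖ = 0
      · simp [h0]
      · apply log_nonneg
        rw [← div_eq_mul_inv, le_div_iff₀ (lt_of_le_of_ne (norm_nonneg a) (Ne.symm h0))]
        linarith
    · rw [locallyFinsuppWithin.apply_eq_zero_of_notMem E (by simpa [abs_of_pos hρ0] using ha)]
      simp
  have hcount : locallyFinsuppWithin.logCounting D ρ
      = ∑ᶠ a, E a * log (ρ * ‖a‖⁻¹) + D 0 * log ρ := rfl
  have hfin : (∑ a ∈ S, E a * log (ρ * ‖a‖⁻¹)) ≤ ∑ᶠ a, E a * log (ρ * ‖a‖⁻¹) := by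
    rw [finsum_eq_sum_of_support_subset (s := hEfin.toFinset ∪ S)]
    · exact Finset.sum_le_sum_of_subset_of_nonneg Finset.subset_union_right
        fun a _ _ ↦ hterm a
    · intro a ha
      have : E a ≠ 0 := by
        intro h
        simp [h] at ha
      simp [this]
  have hzero : (∑ a ∈ S, if a = 0 then (D 0 : ℝ) * log ρ else 0) ≤ D 0 * log ρ := by
    rw [Finset.sum_ite_eq' S 0 fun _ ↦ (D 0 : ℝ) * log ρ]
    split_ifs
    · exact le_rfl
    · exact mul_nonneg (hD' 0) (by linarith)
  have hc : 0 < (ρ - R) / ρ := div_pos (by linarith) hρ0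
  rw [← inv_div, ← div_eq_inv_mul, le_div_iff₀ hc, hcount, Finset.sum_mul]
  calc ∑ a ∈ S, (D a : ℝ) * ((ρ - R) / ρ)
      ≤ ∑ a ∈ S, (E a * log (ρ * ‖a‖⁻¹) + if a = 0 then (D 0 : ℝ) * log ρ else 0) := by
        refine Finset.sum_le_sum fun a ha ↦ ?_
        have haR := hS a ha
        rw [hE a (by linarith)]
        split_ifs with h0
        · subst h0
          have : (ρ - R) / ρ ≤ 1 := by
            rw [div_le_one hρ0]
            linarith [norm_nonneg (0 : ℂ)]
          simp only [norm_zero, inv_zero, mul_zero, log_zero, zero_add]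
          exact mul_le_mul_of_nonneg_left (this.trans hlog) (hD' 0)
        · rw [add_zero]
          refine mul_le_mul_of_nonneg_left ?_ (hD' a)
          have ha0 : 0 < ‖a‖ := norm_pos_iff.2 h0
          have := one_sub_inv_le_log_of_pos (show 0 < ρ * ‖a‖⁻¹ by positivity)
          refine le_trans ?_ this
          rw [mul_inv, inv_inv, sub_div, div_self hρ0.ne', inv_mul_eq_div]
          gcongr
    _ ≤ _ := by
        rw [Finset.sum_add_distrib]
        exact add_le_add hfin hzero

lemma posLog_add_posLog_inv (x : ℝ) : log⁺ x + log⁺ x⁻¹ = |log x| := by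
  rw [← half_mul_log_add_log_abs, ← half_mul_log_add_log_abs, log_inv, abs_neg]
  ring

lemma exists_radius_sphere_order_eq_zero {g : ℂ → ℂ} (hg : Meromorphic g)
    (hg' : ∀ z, meromorphicOrderAt g z ≠ ⊤) {s t : ℝ} (hst : s < t) :
    ∃ R ∈ Ioo s t, ∀ z ∈ sphere (0 : ℂ) R, meromorphicOrderAt g z = 0 := by
  have hfin : (divisor g (closedBall 0 t)).support.Finite :=
    (divisor g (closedBall 0 t)).finiteSupport (isCompact_closedBall _ _)
  obtain ⟨R, hR, hRn⟩ := ((Ioo_infinite hst).sdiff (hfin.image fun z ↦ ‖z‖)).nonempty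
  refine ⟨R, hR, fun z hz ↦ ?_⟩
  have hzR : ‖z‖ = R := by simpa using hz
  have hzt : z ∈ closedBall 0 t := by simpa [hzR] using hR.2.le
  by_contra h0
  apply hRn
  refine ⟨z, ?_, hzR⟩
  rw [mem_support, divisor_apply hg.meromorphicOn hzt]
  intro h
  rcases WithTop.untop₀_eq_zero.1 h with h | h
  · exact h0 h
  · exact hg' z h

/-- The canonical decomposition, differentiated logarithmically: a meromorphic function is a
zero-free function times canonical factors, and the latter have modulus one on the outer circle. -/
lemma exists_logDeriv_eq_add_sum {g : ℂ → ℂ} (hg : Meromorphic g)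
    (hg' : ∀ z, meromorphicOrderAt g z ≠ ⊤) {r R : ℝ} (hr : 0 < r) (hrR : r < R)
    (hR : ∀ z ∈ sphere (0 : ℂ) R, meromorphicOrderAt g z = 0) :
    ∃ (h : ℂ → ℂ) (S : Finset ℂ), AnalyticOnNhd ℂ h (closedBall 0 R) ∧
      (∀ z ∈ closedBall 0 R, h z ≠ 0) ∧ (∀ a ∈ S, ‖a‖ < R) ∧
      (∀ᶠ z in codiscreteWithin (sphere 0 R), ‖h z‖ = ‖g z‖) ∧
      ∀ᶠ z in codiscreteWithin (sphere 0 r), (∀ a ∈ S, z ≠ a) ∧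
        z * logDeriv g z = z * logDeriv h z + ∑ a ∈ S, (divisor g univ a : ℂ) *
          (z / (z - a) + conj a * z / (R ^ 2 - conj a * z)) := by
  have hR0 : 0 < R := hr.trans hrR
  obtain ⟨h, H⟩ := hg.meromorphicOn.exists_ecanonicalDecomp (R := R) fun u ↦ hg' u
  have hfin : (divisor g (ball 0 R)).support.Finite :=
    H.meromorphicOn.divisor_ball_support_finite
  set P : ℂ → ℂ := ∏ᶠ u, (Complex.canonicalFactor R u) ^ (-divisor g (ball 0 R) u) with hP
  have hone : (∏ᶠ v, (· - v) ^ (divisor g (sphere 0 R) v) : ℂ → ℂ) = 1 := by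
    have : ∀ v, divisor g (sphere 0 R) v = 0 := by
      intro v
      by_cases hv : v ∈ sphere (0 : ℂ) R
      · rw [divisor_apply hg.meromorphicOn hv, hR v hv]
        simp
      · exact locallyFinsuppWithin.apply_eq_zero_of_notMem _ hv
    simp [this]
  have heq : g =ᶠ[codiscreteWithin (closedBall 0 R)] P * h := by
    have := H.eventuallyEq
    rwa [hone, mul_one] at this
  have hS : ∀ a ∈ hfin.toFinset, ‖a‖ < R := by
    intro a ha
    by_contra hcon
    have h0 : a ∉ ball (0 : ℂ) R := by simpa using hcon
    rw [Finite.mem_toFinset, mem_support] at ha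
    exact ha (locallyFinsuppWithin.apply_eq_zero_of_notMem _ h0)
  have hPmer : Meromorphic P := fun z ↦ MeromorphicAt.finprod fun u ↦
    (Complex.meromorphic_canonicalFactor R u z).zpow _
  have hPtop : ∀ z, meromorphicOrderAt P z ≠ ⊤ := by
    intro z
    apply meromorphicOrderAt_finprod_ne_top
      (fun u ↦ (Complex.meromorphic_canonicalFactor R u z).zpow _)
    intro c
    rw [meromorphicOrderAt_zpow (Complex.meromorphic_canonicalFactor R c z)]
    lift meromorphicOrderAt (Complex.canonicalFactor R c) z to ℤ using
      (Complex.meromorphicOrderAt_canonicalFactor_ne_top c hR0) with ℓ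
    exact WithTop.coe_ne_top (a := -divisor g (ball 0 R) c * ℓ)
  have hPprod : P = ∏ u ∈ hfin.toFinset,
      (Complex.canonicalFactor R u) ^ (-divisor g (ball 0 R) u) := by
    rw [hP]
    refine finprod_eq_prod_of_mulSupport_subset _ fun u hu ↦ ?_
    simp only [Finite.coe_toFinset, mem_support]
    intro h0
    simp [h0] at hu
  have hsubr : sphere (0 : ℂ) r ⊆ closedBall 0 R := fun z hz ↦ by
    simp only [mem_sphere, dist_zero_right] at hz
    simp [hz, hrR.le]
  refine ⟨h, hfin.toFinset, H.analyticOnNhd, H.ne_zero, hS, ?_, ?_⟩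
  · filter_upwards [heq.filter_mono (codiscreteWithin_mono sphere_subset_closedBall),
      self_mem_codiscreteWithin (sphere (0 : ℂ) R)] with z hz hzR
    rw [hz, Pi.mul_apply, norm_mul, hPprod, Finset.prod_apply, norm_prod, Finset.prod_eq_one,
      one_mul]
    intro a ha
    rw [Pi.pow_apply, norm_zpow,
      Complex.norm_canonicalFactor_eval_circle_eq_one (by simpa using hS a ha) hzR, one_zpow]
  · have hd : (support fun u ↦ -divisor g (ball 0 R) u).Finite :=
      hfin.subset fun u hu h0 ↦ hu (by simp [h0])
    have hlogP := MeromorphicOn.logDeriv_finprod_zpow_eventuallyEq (U := closedBall 0 R) hd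
      (fun u ↦ (Complex.meromorphic_canonicalFactor R u).meromorphicOn)
      (fun u z _ ↦ Complex.meromorphicOrderAt_canonicalFactor_ne_top u hR0)
    rw [← hP] at hlogP
    have hhmer : MeromorphicOn h (closedBall 0 R) := fun z hz ↦ (H.analyticOnNhd z hz).meromorphicAt
    have hhtop : ∀ z ∈ closedBall 0 R, meromorphicOrderAt h z ≠ ⊤ := by
      intro z hz
      rw [(H.analyticOnNhd z hz).meromorphicNFAt.meromorphicOrderAt_eq_zero_iff.2 (H.ne_zero z hz)]
      simp
    have hmul := hPmer.meromorphicOn.logDeriv_mul_eventuallyEq hhmer (fun z _ ↦ hPtop z) hhtop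
    have hder := MeromorphicOn.deriv_eventuallyEq_codiscreteWithin hg.meromorphicOn
      (hPmer.meromorphicOn.mul hhmer) heq
    have hne : ∀ᶠ z in codiscreteWithin (closedBall (0 : ℂ) R), z ∉ hfin.toFinset := by
      have := codiscreteWithin_mono (subset_univ (closedBall (0 : ℂ) R)) hfin.compl_mem_codiscrete
      filter_upwards [this] with z hz
      simpa using hz
    filter_upwards [hlogP.filter_mono (codiscreteWithin_mono hsubr),
      hmul.filter_mono (codiscreteWithin_mono hsubr),
      hder.filter_mono (codiscreteWithin_mono hsubr),
      heq.filter_mono (codiscreteWithin_mono hsubr),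
      hne.filter_mono (codiscreteWithin_mono hsubr),
      self_mem_codiscreteWithin (sphere (0 : ℂ) r)] with z h1 h2 h3 h4 h5 h6
    have hz : ‖z‖ = r := by simpa using h6
    refine ⟨fun a ha hza ↦ h5 (hza ▸ ha), ?_⟩
    have h7 : logDeriv g z = logDeriv (P * h) z := by
      rw [logDeriv_apply, logDeriv_apply, h3, h4]
    rw [h7, h2, Pi.add_apply, h1, mul_add, add_comm]
    congr 1
    rw [finsum_eq_sum_of_support_subset (s := hfin.toFinset), Finset.mul_sum]
    · refine Finset.sum_congr rfl fun a ha ↦ ?_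
      have haR := hS a ha
      have hden : (R : ℂ) ^ 2 - conj a * z ≠ 0 := by
        intro h0
        have h8 : ‖conj a * z‖ = R ^ 2 := by
          rw [← sub_eq_zero.1 h0]
          simp
        rw [norm_mul, Complex.norm_conj, hz] at h8
        nlinarith [norm_nonneg a]
      have h9 : divisor g (ball 0 R) a = divisor g univ a := by
        rw [divisor_apply hg.meromorphicOn (by simpa using haR),
          divisor_apply hg.meromorphicOn (mem_univ a)]
      have hza : z ≠ a := by
        rintro rfl
        exact h5 ha
      have h10 := mul_logDeriv_canonicalFactor hR0.ne' hza hden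
      rw [h9, zsmul_eq_mul, mul_left_comm, h10]
      push_cast
      ring
    · intro u hu
      simp only [Finite.coe_toFinset, mem_support]
      intro h0
      simp [h0] at hu

/-- The contribution of zeros and poles to the logarithmic derivative is a combination of
Carathéodory functions. The terms with `‖a‖ ≤ r` have to be reflected in the circle `‖z‖ = r`, which
produces a complex conjugate; grouping them keeps the number of functions equal to six. -/
lemma norm_sum_le_sum_isCaratheodory {r R : ℝ} (hr : 0 < r) (hrR : r < R) (S : Finset ℂ)
    (hS : ∀ a ∈ S, ‖a‖ < R) (n : ℂ → ℤ) :
    ∃ (h : Fin 6 → ℂ → ℂ) (M : Fin 6 → ℝ), (∀ i, IsCaratheodory r (h i) (M i)) ∧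
      ∑ i, M i = ∑ a ∈ S, (((n a)⁺ : ℤ) : ℝ) + ∑ a ∈ S, (((n a)⁻ : ℤ) : ℝ) ∧
      ∀ z ∈ sphere 0 r, (∀ a ∈ S, z ≠ a) →
        ‖∑ a ∈ S, (n a : ℂ) * (z / (z - a) + conj a * z / (R ^ 2 - conj a * z))‖
          ≤ ∑ i, ‖h i z‖ := by
  classical
  have hR : 0 < R := hr.trans hrR
  set S₁ := S.filter fun a ↦ ‖a‖ ≤ r
  set S₂ := S.filter fun a ↦ ¬ ‖a‖ ≤ r
  let K : Finset ℂ → (ℂ → ℂ) → (ℂ → ℤ) → ℂ → ℂ := fun T w m z ↦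
    ∑ a ∈ T, ((m a : ℝ) : ℂ) * halfPlaneKernel (w a) z
  have hC : ∀ (T : Finset ℂ) (w : ℂ → ℂ) (m : ℂ → ℤ), (∀ a ∈ T, ‖w a‖ * r ≤ 1) → (∀ a, 0 ≤ m a) →
      IsCaratheodory r (K T w m) (∑ a ∈ T, (m a : ℝ) * 2⁻¹) := fun T w m hw hm ↦
    IsCaratheodory.sum T fun a ha ↦ (isCaratheodory_halfPlaneKernel (hw a ha)).const_mul
      (by exact_mod_cast hm a)
  have hw₁ : ∀ a ∈ S₁, ‖conj a / (r : ℂ) ^ 2‖ * r ≤ 1 := by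
    intro a ha
    have : ‖a‖ ≤ r := (Finset.mem_filter.1 ha).2
    rw [norm_div, Complex.norm_conj, norm_pow, Complex.norm_real, norm_of_nonneg hr.le]
    rw [div_mul_eq_mul_div, div_le_one (by positivity)]
    nlinarith
  have hw₂ : ∀ a ∈ S₂, ‖a⁻¹‖ * r ≤ 1 := by
    intro a ha
    have h1 : r < ‖a‖ := not_le.1 (Finset.mem_filter.1 ha).2
    rw [norm_inv, inv_mul_le_iff₀ (hr.trans h1)]
    linarith
  have hw₃ : ∀ a ∈ S, ‖conj a / (R : ℂ) ^ 2‖ * r ≤ 1 := by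
    intro a ha
    have := hS a ha
    rw [norm_div, Complex.norm_conj, norm_pow, Complex.norm_real, norm_of_nonneg hR.le]
    rw [div_mul_eq_mul_div, div_le_one (by positivity)]
    nlinarith
  have hp : ∀ a, 0 ≤ (n a)⁺ := fun a ↦ posPart_nonneg _
  have hq : ∀ a, 0 ≤ (n a)⁻ := fun a ↦ negPart_nonneg _
  let p : ℂ → ℤ := fun a ↦ (n a)⁺
  let q : ℂ → ℤ := fun a ↦ (n a)⁻
  let w₁ : ℂ → ℂ := fun a ↦ conj a / (r : ℂ) ^ 2
  let w₃ : ℂ → ℂ := fun a ↦ conj a / (R : ℂ) ^ 2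
  refine ⟨![K S₁ w₁ p, K S₁ w₁ q, K S₂ (·⁻¹) p, K S₂ (·⁻¹) q, K S w₃ p, K S w₃ q],
    ![∑ a ∈ S₁, (p a : ℝ) * 2⁻¹, ∑ a ∈ S₁, (q a : ℝ) * 2⁻¹, ∑ a ∈ S₂, (p a : ℝ) * 2⁻¹,
      ∑ a ∈ S₂, (q a : ℝ) * 2⁻¹, ∑ a ∈ S, (p a : ℝ) * 2⁻¹, ∑ a ∈ S, (q a : ℝ) * 2⁻¹], ?_, ?_, ?_⟩
  · simp only [Fin.forall_fin_succ, Matrix.cons_val_zero, Matrix.cons_val_succ, IsEmpty.forall_iff,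
      and_true]
    exact ⟨hC _ _ _ hw₁ hp, hC _ _ _ hw₁ hq, hC _ _ _ hw₂ hp, hC _ _ _ hw₂ hq, hC _ _ _ hw₃ hp,
      hC _ _ _ hw₃ hq⟩
  · have hsplit : ∀ m : ℂ → ℤ, ∑ a ∈ S₁, (m a : ℝ) + ∑ a ∈ S₂, (m a : ℝ) = ∑ a ∈ S, (m a : ℝ) :=
      fun m ↦ Finset.sum_filter_add_sum_filter_not S _ _
    simp only [Fin.sum_univ_succ, Matrix.cons_val_zero, Matrix.cons_val_succ, Finset.univ_eq_empty,
      Finset.sum_empty, ← Finset.sum_mul]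
    linear_combination 2⁻¹ * hsplit p + 2⁻¹ * hsplit q
  · intro z hz hzS
    have hzr : ‖z‖ = r := by simpa using hz
    have hden : ∀ a ∈ S, (R : ℂ) ^ 2 - conj a * z ≠ 0 := by
      intro a ha h0
      have h8 : ‖conj a * z‖ = R ^ 2 := by
        rw [← sub_eq_zero.1 h0]
        simp
      rw [norm_mul, Complex.norm_conj, hzr] at h8
      nlinarith [norm_nonneg a, hS a ha]
    have hn : ∀ a, (n a : ℂ) = ((p a : ℝ) : ℂ) - ((q a : ℝ) : ℂ) := by
      intro a
      have := posPart_sub_negPart (n a)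
      have h2 : ((p a - q a : ℤ) : ℂ) = (n a : ℂ) := by rw [← this]
      push_cast at h2 ⊢
      exact h2.symm
    have hsum : ∑ a ∈ S, (n a : ℂ) * (z / (z - a) + conj a * z / (R ^ 2 - conj a * z))
        = conj (K S₁ w₁ p z) - conj (K S₁ w₁ q z) - K S₂ (·⁻¹) p z + K S₂ (·⁻¹) q z
          + K S w₃ p z - K S w₃ q z := by
      have h1 : ∑ a ∈ S₁, (n a : ℂ) * (z / (z - a) + conj a * z / (R ^ 2 - conj a * z))
          = conj (K S₁ w₁ p z) - conj (K S₁ w₁ q z) + K S₁ w₃ p z - K S₁ w₃ q z := by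
        simp only [K, map_sum, ← Finset.sum_sub_distrib, ← Finset.sum_add_distrib]
        refine Finset.sum_congr rfl fun a ha ↦ ?_
        have haS := (Finset.mem_filter.1 ha).1
        rw [halfPlaneKernel_reflection hr hzr (hzS a haS) (hden a haS) hR.ne', hn]
        simp only [map_mul, Complex.conj_ofReal, w₁, w₃]
        ring
      have h2 : ∑ a ∈ S₂, (n a : ℂ) * (z / (z - a) + conj a * z / (R ^ 2 - conj a * z))
          = - K S₂ (·⁻¹) p z + K S₂ (·⁻¹) q z + K S₂ w₃ p z - K S₂ w₃ q z := by
        simp only [K, ← Finset.sum_sub_distrib, ← Finset.sum_add_distrib, ← Finset.sum_neg_distrib]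
        refine Finset.sum_congr rfl fun a ha ↦ ?_
        have haS := (Finset.mem_filter.1 ha).1
        have ha0 : a ≠ 0 := by
          rintro rfl
          exact (Finset.mem_filter.1 ha).2 (by simpa using hr.le)
        rw [halfPlaneKernel_outside ha0 (hzS a haS) (hden a haS) hR.ne', hn]
        simp only [w₃]
        ring
      have h3 : ∀ m, K S w₃ m z = K S₁ w₃ m z + K S₂ w₃ m z := fun m ↦
        (Finset.sum_filter_add_sum_filter_not S _ _).symm
      rw [← Finset.sum_filter_add_sum_filter_not S (fun a ↦ ‖a‖ ≤ r), h1, h2, h3, h3]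
      ring
    rw [hsum]
    simp only [Fin.sum_univ_succ, Matrix.cons_val_zero, Matrix.cons_val_succ, Finset.univ_eq_empty,
      Finset.sum_empty]
    refine (norm_sub_le _ _).trans ?_
    refine (add_le_add_left ((norm_add_le _ _).trans (add_le_add_left ((norm_add_le _ _).trans
      (add_le_add_left ((norm_sub_le _ _).trans (add_le_add_left (norm_sub_le _ _) _)) _)) _))
        _).trans ?_
    rw [Complex.norm_conj, Complex.norm_conj]
    linarith

lemma proximity_le_characteristic (u : ℂ → ℂ) {r : ℝ} (hr : 1 ≤ r) :
    proximity u ⊤ r ≤ characteristic u ⊤ r :=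
  le_add_of_nonneg_right (logCounting_nonneg hr)

lemma logCounting_le_characteristic (u : ℂ → ℂ) (r : ℝ) :
    logCounting u ⊤ r ≤ characteristic u ⊤ r :=
  le_add_of_nonneg_left (proximity_nonneg r)

/-- The logarithmic derivative of a meromorphic function `g` is dominated on a circle by seven
Carathéodory functions, whose total mass is controlled by the characteristic of `g`. -/
theorem exists_isCaratheodory_logDeriv {g : ℂ → ℂ} (hg : Meromorphic g)
    (hg' : ∀ z, meromorphicOrderAt g z ≠ ⊤) {r ρ : ℝ} (hr : 3 ≤ r) (hrρ : r < ρ) :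
    ∃ (h : Fin 7 → ℂ → ℂ) (M : Fin 7 → ℝ), (∀ i, IsCaratheodory r (h i) (M i)) ∧
      ∑ i, M i ≤ 4.1 * (ρ / (ρ - r)) * (characteristic g ⊤ ρ + characteristic g⁻¹ ⊤ ρ) ∧
      ∀ᶠ z in codiscreteWithin (sphere 0 r), ‖z * logDeriv g z‖ ≤ ∑ i, ‖h i z‖ := by
  have hr0 : 0 < r := by linarith
  -- a radius slightly beyond the midpoint of `[r, ρ]` whose circle avoids all zeros and poles
  obtain ⟨R, ⟨hR₁, hR₂⟩, hR⟩ := exists_radius_sphere_order_eq_zero hg hg'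
    (show (r + ρ) / 2 < ρ - (ρ - r) / 2.05 by norm_num; linarith)
  have hrR : r < R := by linarith
  have hRρ : R < ρ := by
    have : 0 < (ρ - r) / 2.05 := div_pos (by linarith) (by norm_num)
    linarith
  have hR0 : 0 < R := by linarith
  obtain ⟨h, S, hh, hh0, hS, hnorm, hlog⟩ := exists_logDeriv_eq_add_sum hg hg' hr0 hrR hR
  obtain ⟨G, hG, hGle⟩ := exists_isCaratheodory_of_ne_zero hr0 hrR hh hh0
  obtain ⟨k, M, hk, hM, hkle⟩ := norm_sum_le_sum_isCaratheodory hr0 hrR S hS (divisor g univ)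
  refine ⟨Fin.cons G k, Fin.cons _ M, Fin.cases hG hk, ?_, ?_⟩
  · have hprox : circleAverage (fun ζ ↦ |log ‖h ζ‖|) 0 R
        = proximity g ⊤ R + proximity g⁻¹ ⊤ R := by
      rw [proximity_top, proximity_top, ← circleAverage_add
        hg.meromorphicOn.circleIntegrable_posLog_norm
        hg.inv.meromorphicOn.circleIntegrable_posLog_norm]
      refine circleAverage_congr_codiscreteWithin ?_ hR0.ne'
      rw [abs_of_pos hR0]
      filter_upwards [hnorm] with z hz
      rw [hz, ← posLog_add_posLog_inv]
      simp
    have hpos : ∑ a ∈ S, (((divisor g univ a)⁺ : ℤ) : ℝ) ≤ ρ / (ρ - R) * logCounting g 0 ρ := by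
      rw [logCounting_zero]
      exact sum_le_logCounting (posPart_nonneg _) hRρ (by linarith) S hS
    have hneg : ∑ a ∈ S, (((divisor g univ a)⁻ : ℤ) : ℝ) ≤ ρ / (ρ - R) * logCounting g ⊤ ρ := by
      rw [logCounting_top]
      exact sum_le_logCounting (negPart_nonneg _) hRρ (by linarith) S hS
    have hmono : ∀ {u : ℂ → ℂ}, Meromorphic u → proximity u ⊤ R ≤ characteristic u ⊤ ρ :=
      fun hu ↦ (proximity_le_characteristic _ (by linarith)).trans
        (characteristic_monotoneOn hu (mem_Ioi.2 hR0) (mem_Ioi.2 (hR0.trans hRρ)) hRρ.le)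
    have h1 := hmono hg
    have h2 := hmono hg.inv
    have h3 := logCounting_le_characteristic g ρ
    have h4 := logCounting_le_characteristic g⁻¹ ρ
    rw [logCounting_inv] at h4
    have hT : 0 ≤ characteristic g ⊤ ρ := characteristic_nonneg (by linarith)
    have hT' : 0 ≤ characteristic g⁻¹ ⊤ ρ := characteristic_nonneg (by linarith)
    have hc₁ : 2 * R * r / (R ^ 2 - r ^ 2) ≤ 2 * (ρ / (ρ - r)) := by
      rw [← mul_div_assoc, div_le_div_iff₀ (by nlinarith) (by linarith)]
      have a1 : 2 * R * r * (ρ - r) ≤ 2 * R * r * (2 * (R - r)) :=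
        mul_le_mul_of_nonneg_left (by linarith) (by positivity)
      have a2 : R * (2 * r) ≤ ρ * (R + r) :=
        mul_le_mul hRρ.le (by linarith) (by positivity) (by linarith)
      have a3 := mul_le_mul_of_nonneg_right a2 (sub_pos.2 hrR).le
      linarith
    have hc₂ : ρ / (ρ - R) ≤ 2.05 * (ρ / (ρ - r)) := by
      rw [← mul_div_assoc, div_le_div_iff₀ (by linarith) (by linarith)]
      have : (ρ - r) / 2.05 ≤ ρ - R := by linarith
      rw [div_le_iff₀ (by norm_num)] at this
      nlinarith
    have hq : 0 ≤ ρ / (ρ - r) := div_nonneg (by linarith) (by linarith)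
    rw [Fin.sum_cons, hprox, hM]
    have e0 : 0 ≤ proximity g ⊤ R + proximity g⁻¹ ⊤ R :=
      add_nonneg (proximity_nonneg R) (proximity_nonneg R)
    have e1 := mul_le_mul_of_nonneg_right hc₁ e0
    have e2 := mul_le_mul_of_nonneg_left (add_le_add h1 h2) (mul_nonneg zero_le_two hq)
    have e3 := hpos.trans (mul_le_mul_of_nonneg_left h4 (div_nonneg (by linarith) (by linarith)))
    have e4 := hneg.trans (mul_le_mul_of_nonneg_left h3 (div_nonneg (by linarith) (by linarith)))
    have e5 := mul_le_mul_of_nonneg_right hc₂ (add_nonneg hT hT')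
    have e6 := mul_nonneg hq (add_nonneg hT hT')
    linarith
  · filter_upwards [hlog, self_mem_codiscreteWithin (sphere (0 : ℂ) r)] with z hz hzr
    rw [hz.2, Fin.sum_univ_succ]
    refine (norm_add_le _ _).trans (add_le_add (hGle z hzr) (hkle z hzr hz.1))

/-! ### Growth of the characteristic of a nonconstant function -/

lemma Meromorphic.meromorphicOrderAt_ne_top {g : ℂ → ℂ} (hg : Meromorphic g)
    (h : ¬ g =ᶠ[codiscrete ℂ] 0) (z : ℂ) : meromorphicOrderAt g z ≠ ⊤ := by
  by_contra hz
  apply h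
  have hall : ∀ w, meromorphicOrderAt g w = ⊤ := by
    intro w
    by_contra hw
    exact hg.exists_meromorphicOrderAt_ne_top_iff_forall.1 ⟨w, hw⟩ z hz
  change {x | g x = 0} ∈ codiscreteWithin univ
  rw [mem_codiscreteWithin_iff_forall_mem_nhdsNE]
  intro w _
  filter_upwards [meromorphicOrderAt_eq_top_iff.1 (hall w)] with x hx
  simp [hx]

/-- A nonconstant meromorphic function takes some value, and the counting function of that value
grows at least like the logarithm. -/
theorem tendsto_characteristic_atTop {f : ℂ → ℂ} (hf : Meromorphic f)
    (hc : ∀ c : ℂ, ¬ f =ᶠ[codiscrete ℂ] fun _ ↦ c) :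
    Tendsto (characteristic f ⊤) atTop atTop := by
  classical
  obtain ⟨w, hw⟩ : ∃ w, AnalyticAt ℂ f w :=
    (hf 0).eventually_analyticAt.exists
  set g : ℂ → ℂ := (f · - f w)
  have hg : Meromorphic g := hf.sub (Meromorphic.const _)
  have hg0 : ¬ g =ᶠ[codiscrete ℂ] 0 := by
    intro h
    apply hc (f w)
    filter_upwards [h] with z hz
    exact sub_eq_zero.1 hz
  have hgw : AnalyticAt ℂ g w := hw.sub analyticAt_const
  have hord : 1 ≤ divisor g univ w := by
    have htop := hg.meromorphicOrderAt_ne_top hg0 w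
    rw [divisor_apply hg.meromorphicOn (mem_univ w)]
    have hne : meromorphicOrderAt g w ≠ 0 := by
      intro h
      have := hgw.meromorphicNFAt.meromorphicOrderAt_eq_zero_iff.1 h
      simp [g] at this
    have hnn := hgw.meromorphicOrderAt_nonneg
    lift meromorphicOrderAt g w to ℤ using htop with n
    norm_cast at hne hnn
    rw [WithTop.untop₀_coe]
    omega
  have hle : locallyFinsuppWithin.single w 1 ≤ (divisor g univ)⁺ := by
    intro z
    by_cases hz : z = w
    · subst hz
      rw [locallyFinsuppWithin.single_apply, if_pos rfl]
      exact hord.trans (le_posPart (divisor g univ z))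
    · rw [locallyFinsuppWithin.single_apply, if_neg hz]
      exact posPart_nonneg (divisor g univ z)
  have hbound : ∀ᶠ r in atTop, log r + (log ‖meromorphicTrailingCoeffAt g 0‖ - log ‖w‖
      - (log⁺ ‖f w‖ + log 2)) ≤ characteristic f ⊤ r := by
    filter_upwards [eventually_ge_atTop 1, eventually_ge_atTop ‖w‖] with r hr hrw
    have h1 := locallyFinsuppWithin.logCounting_le hle hr
    rw [locallyFinsuppWithin.logCounting_single_eq_log_sub_const hrw, ← logCounting_zero,
      ← logCounting_inv] at h1
    have h2 := h1.trans (logCounting_le_characteristic g⁻¹ r)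
    have h3 := characteristic_sub_characteristic_inv_of_ne_zero hg (by linarith : r ≠ 0)
    have h4 := abs_le.1 (abs_characteristic_sub_characteristic_shift_le hf (a₀ := f w) (r := r))
    push_cast at h2
    linarith [h4.1]
  exact tendsto_atTop_mono' _ hbound (tendsto_atTop_add_const_right _ _ tendsto_log_atTop)

/-! ### Derivatives and orders -/

lemma meromorphicOrderAt_deriv_nonneg {f : ℂ → ℂ} {x : ℂ} (hf : MeromorphicAt f x)
    (h : 0 ≤ meromorphicOrderAt f x) : 0 ≤ meromorphicOrderAt (deriv f) x := by
  have heq : f =ᶠ[𝓝[≠] x] toMeromorphicNFAt f x := hf.eq_nhdsNE_toMeromorphicNFAt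
  have han : AnalyticAt ℂ (toMeromorphicNFAt f x) x := by
    rw [← meromorphicNFAt_toMeromorphicNFAt.meromorphicOrderAt_nonneg_iff_analyticAt]
    rwa [← meromorphicOrderAt_congr heq]
  rw [meromorphicOrderAt_congr heq.nhdsNE_deriv]
  exact han.deriv.meromorphicOrderAt_nonneg

lemma neg_le_meromorphicOrderAt_deriv {f : ℂ → ℂ} {x : ℂ} (hf : MeromorphicAt f x) {n : ℕ}
    (h : ((-n : ℤ) : WithTop ℤ) ≤ meromorphicOrderAt f x) :
    ((-(n + 1) : ℤ) : WithTop ℤ) ≤ meromorphicOrderAt (deriv f) x := by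
  rcases le_or_gt 0 (meromorphicOrderAt f x) with h0 | h0
  · refine le_trans ?_ (meromorphicOrderAt_deriv_nonneg hf h0)
    norm_cast
    omega
  · lift meromorphicOrderAt f x to ℤ using h0.ne_top with k hk
    norm_cast at h h0
    rw [meromorphicOrderAt_deriv_eq_sub_one (n := k) (by exact_mod_cast h0.ne) hk.symm]
    norm_cast
    omega

/-- A pole of order `n` of `f` is a pole of order at most `(j + 1) * n` of the `j`-th derivative. -/
lemma neg_le_meromorphicOrderAt_iterate_deriv {f : ℂ → ℂ} {x : ℂ} (hf : MeromorphicAt f x) {n : ℕ}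
    (h : ((-n : ℤ) : WithTop ℤ) ≤ meromorphicOrderAt f x) (j : ℕ) :
    ((-((j + 1) * n) : ℤ) : WithTop ℤ) ≤ meromorphicOrderAt (deriv^[j] f) x := by
  rcases Nat.eq_zero_or_pos n with rfl | hn
  · have : ∀ j, 0 ≤ meromorphicOrderAt (deriv^[j] f) x := by
      intro j
      induction j with
      | zero => simpa using h
      | succ j ih =>
        rw [iterate_succ_apply']
        exact meromorphicOrderAt_deriv_nonneg hf.iterated_deriv ih
    simpa using this j
  · have : ∀ j : ℕ, ((-((n + j : ℕ) : ℤ) : ℤ) : WithTop ℤ)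
        ≤ meromorphicOrderAt (deriv^[j] f) x := by
      intro j
      induction j with
      | zero => simpa using h
      | succ j ih =>
        rw [iterate_succ_apply']
        refine le_trans (le_of_eq ?_) (neg_le_meromorphicOrderAt_deriv hf.iterated_deriv ih)
        norm_cast
    refine le_trans ?_ (this j)
    norm_cast
    push_cast
    nlinarith

/-- The function `z ↦ z ^ j * f⁽ʲ⁾(z)`. Unlike the derivative itself, it has at the origin an order
no smaller than that of `f`. -/
noncomputable def eulerDeriv (j : ℕ) (f : ℂ → ℂ) (z : ℂ) : ℂ := z ^ j * iteratedDeriv j f z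

lemma Meromorphic.iteratedDeriv {f : ℂ → ℂ} (hf : Meromorphic f) (j : ℕ) :
    Meromorphic (iteratedDeriv j f) := by
  rw [iteratedDeriv_eq_iterate]
  exact hf.iterated_deriv

lemma Meromorphic.eulerDeriv {f : ℂ → ℂ} (hf : Meromorphic f) (j : ℕ) :
    Meromorphic (eulerDeriv j f) :=
  Meromorphic.mul (fun _ ↦ by fun_prop) (hf.iteratedDeriv j)

/-- If `f` is `z ^ k` times an analytic function near the origin, then so is `eulerDeriv j f`. -/
lemma exists_eulerDeriv_eq_zpow_mul {f g : ℂ → ℂ} {k : ℤ} (hg : AnalyticAt ℂ g 0)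
    (h : f =ᶠ[𝓝[≠] 0] fun z ↦ z ^ k * g z) (j : ℕ) :
    ∃ g', AnalyticAt ℂ g' 0 ∧ eulerDeriv j f =ᶠ[𝓝[≠] 0] fun z ↦ z ^ k * g' z := by
  have key : ∀ j : ℕ, ∃ g', AnalyticAt ℂ g' 0 ∧
      iteratedDeriv j f =ᶠ[𝓝[≠] 0] fun z ↦ z ^ (k - j) * g' z := by
    intro j
    induction j with
    | zero => exact ⟨g, hg, by simpa using h⟩
    | succ j ih =>
      obtain ⟨u, hu, hfu⟩ := ih
      refine ⟨fun z ↦ ((k - j : ℤ) : ℂ) * u z + z * deriv u z, by fun_prop, ?_⟩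
      rw [iteratedDeriv_succ]
      filter_upwards [hfu.nhdsNE_deriv, hu.eventually_analyticAt.filter_mono nhdsWithin_le_nhds,
        self_mem_nhdsWithin] with z hz huz hz0
      have hz0 : z ≠ 0 := hz0
      rw [hz, ((hasDerivAt_zpow (k - j) z (Or.inl hz0)).fun_mul
        huz.differentiableAt.hasDerivAt).deriv]
      have : k - ((j + 1 : ℕ) : ℤ) = k - j - 1 := by push_cast; ring
      rw [this]
      have h2 : z ^ (k - j) = z ^ (k - j - 1) * z := by
        rw [← zpow_add_one₀ hz0]
        ring_nf
      rw [h2]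
      ring
  obtain ⟨u, hu, hfu⟩ := key j
  refine ⟨u, hu, ?_⟩
  filter_upwards [hfu, self_mem_nhdsWithin] with z hz hz0
  have hz0 : z ≠ 0 := hz0
  rw [eulerDeriv, hz, ← mul_assoc, ← zpow_natCast, ← zpow_add₀ hz0]
  ring_nf

lemma mul_deriv_eulerDeriv {f : ℂ → ℂ} {z : ℂ} (hf : AnalyticAt ℂ f z) (j : ℕ) :
    z * deriv (eulerDeriv j f) z = j * eulerDeriv j f z + eulerDeriv (j + 1) f z := by
  have h1 : DifferentiableAt ℂ (iteratedDeriv j f) z := by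
    rw [iteratedDeriv_eq_iterate]
    exact (hf.iterated_deriv j).differentiableAt
  have h2 := (hasDerivAt_pow j z).mul h1.hasDerivAt
  have h3 : eulerDeriv j f = (fun x ↦ x ^ j) * iteratedDeriv j f := rfl
  rw [h3, h2.deriv, ← iteratedDeriv_succ]
  simp only [Pi.mul_apply, eulerDeriv]
  rcases j with _ | j
  · simp
  · simp only [Nat.add_sub_cancel]
    ring

/-! ### The auxiliary function -/

/-- The function `z ^ j * f⁽ʲ⁾ / κ ^ j + f`. The scale `κ` is a positive constant on each circle; it
makes both summands comparable. -/
noncomputable def eulerSum (j : ℕ) (κ : ℝ) (f : ℂ → ℂ) (z : ℂ) : ℂ :=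
  eulerDeriv j f z / (κ : ℂ) ^ j + f z

lemma Meromorphic.eulerSum {f : ℂ → ℂ} (hf : Meromorphic f) (j : ℕ) (κ : ℝ) :
    Meromorphic (eulerSum j κ f) :=
  ((hf.eulerDeriv j).div (Meromorphic.const _)).add hf

/-- At the origin, `eulerSum j κ f` has the same order as `f` and a trailing coefficient of
comparable size, once `κ` is large. -/
lemma exists_forall_le_eulerSum_order {f : ℂ → ℂ} (hf : Meromorphic f)
    (hf0 : meromorphicOrderAt f 0 ≠ ⊤) {j : ℕ} (hj : 1 ≤ j) :
    ∃ K : ℝ, ∀ κ, K ≤ κ → meromorphicOrderAt (eulerSum j κ f) 0 = meromorphicOrderAt f 0 ∧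
      ‖meromorphicTrailingCoeffAt f 0‖ / 2 ≤ ‖meromorphicTrailingCoeffAt (eulerSum j κ f) 0‖ := by
  obtain ⟨g, hg, hg0, hfg⟩ := (meromorphicOrderAt_ne_top_iff (hf 0)).1 hf0
  have hfg' : f =ᶠ[𝓝[≠] 0] fun z ↦ z ^ (meromorphicOrderAt f 0).untop₀ * g z := by
    simpa using hfg
  obtain ⟨u, hu, hfu⟩ := exists_eulerDeriv_eq_zpow_mul hg hfg' j
  have hpos : 0 < ‖g 0‖ := norm_pos_iff.2 hg0
  refine ⟨max 1 (2 * ‖u 0‖ / ‖g 0‖), fun κ hκ ↦ ?_⟩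
  have hκ1 : 1 ≤ κ := (le_max_left _ _).trans hκ
  have hκ2 : 2 * ‖u 0‖ ≤ κ * ‖g 0‖ := by
    rw [← div_le_iff₀ hpos]
    exact (le_max_right _ _).trans hκ
  set v : ℂ → ℂ := fun z ↦ u z / (κ : ℂ) ^ j + g z with hv
  have hva : AnalyticAt ℂ v 0 := by
    have : (κ : ℂ) ^ j ≠ 0 := pow_ne_zero _ (by exact_mod_cast (by linarith : κ ≠ 0))
    fun_prop (disch := assumption)
  have hsmall : ‖u 0 / (κ : ℂ) ^ j‖ ≤ ‖g 0‖ / 2 := by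
    rw [norm_div, norm_pow, Complex.norm_real, norm_of_nonneg (by linarith),
      div_le_iff₀ (by positivity)]
    have : κ ≤ κ ^ j := le_self_pow₀ hκ1 (by omega)
    nlinarith
  have hlow : ‖g 0‖ / 2 ≤ ‖v 0‖ := by
    have := norm_sub_le (v 0) (u 0 / (κ : ℂ) ^ j)
    have h2 : v 0 - u 0 / (κ : ℂ) ^ j = g 0 := by simp [v]
    rw [h2] at this
    linarith
  have hv0 : v 0 ≠ 0 := by
    rw [← norm_pos_iff]
    linarith
  have heq : eulerSum j κ f =ᶠ[𝓝[≠] 0]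
      fun z ↦ (z - 0) ^ (meromorphicOrderAt f 0).untop₀ • v z := by
    filter_upwards [hfg', hfu] with z h1 h2
    rw [eulerSum, h1, h2, sub_zero, smul_eq_mul]
    ring
  refine ⟨?_, ?_⟩
  · rw [(meromorphicOrderAt_eq_int_iff (hf.eulerSum j κ 0)).2 ⟨v, hva, hv0, heq⟩,
      WithTop.coe_untop₀_of_ne_top hf0]
  · rw [hva.meromorphicTrailingCoeffAt_of_ne_zero_of_eq_nhdsNE hv0 heq,
      hg.meromorphicTrailingCoeffAt_of_ne_zero_of_eq_nhdsNE hg0 hfg]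
    exact hlow

lemma negPart_divisor_eulerSum_le {f : ℂ → ℂ} (hf : Meromorphic f)
    (hf0 : ∀ z, meromorphicOrderAt f z ≠ ⊤) {j : ℕ} {κ : ℝ} (hκ : κ ≠ 0)
    (h0 : meromorphicOrderAt (eulerSum j κ f) 0 = meromorphicOrderAt f 0) :
    (divisor (eulerSum j κ f) univ)⁻ ≤ (j + 1) • (divisor f univ)⁻ := by
  have hF := hf.eulerSum j κ
  intro z
  change (divisor (eulerSum j κ f) univ z)⁻ ≤ (j + 1) • (divisor f univ z)⁻
  have hnn : 0 ≤ (divisor f univ z)⁻ := negPart_nonneg _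
  by_cases hz : z = 0
  · subst hz
    rw [divisor_apply hF.meromorphicOn (mem_univ _), divisor_apply hf.meromorphicOn (mem_univ _),
      h0, ← divisor_apply hf.meromorphicOn (mem_univ _)]
    exact le_self_nsmul hnn (by omega)
  · obtain ⟨n, hn⟩ := Int.eq_ofNat_of_zero_le hnn
    have hord : ((-n : ℤ) : WithTop ℤ) ≤ meromorphicOrderAt f z := by
      have h1 : -(n : ℤ) ≤ divisor f univ z := by
        have h2 := neg_le_negPart (divisor f univ z)
        rw [hn] at h2
        linarith
      rw [divisor_apply hf.meromorphicOn (mem_univ _)] at h1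
      rw [← WithTop.coe_untop₀_of_ne_top (hf0 z)]
      exact_mod_cast h1
    have hder := neg_le_meromorphicOrderAt_iterate_deriv (hf z) hord j
    have heul : ((-((j + 1) * n) : ℤ) : WithTop ℤ)
        ≤ meromorphicOrderAt (fun z ↦ eulerDeriv j f z / (κ : ℂ) ^ j) z := by
      have hκj : (κ : ℂ) ^ j ≠ 0 := pow_ne_zero _ (by exact_mod_cast hκ)
      have heq : (fun z ↦ eulerDeriv j f z / (κ : ℂ) ^ j)
          = (fun z ↦ z ^ j / (κ : ℂ) ^ j) * deriv^[j] f := by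
        ext z
        rw [eulerDeriv, iteratedDeriv_eq_iterate, Pi.mul_apply]
        ring
      rwa [heq, meromorphicOrderAt_mul_of_ne_zero (g := fun z ↦ z ^ j / (κ : ℂ) ^ j)
        (by fun_prop (disch := assumption)) (div_ne_zero (pow_ne_zero _ hz) hκj)]
    have hle : ((-((j + 1) * n) : ℤ) : WithTop ℤ) ≤ meromorphicOrderAt (eulerSum j κ f) z := by
      refine le_trans (le_min heul (le_trans ?_ hord))
        (meromorphicOrderAt_add (((hf.eulerDeriv j).div (Meromorphic.const _)) z) (hf z))
      rw [WithTop.coe_le_coe]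
      nlinarith
    rw [hn, divisor_apply hF.meromorphicOn (mem_univ _), nsmul_eq_mul]
    refine sup_le ?_ (by positivity)
    rcases eq_or_ne (meromorphicOrderAt (eulerSum j κ f) z) ⊤ with htop | htop
    · rw [htop]
      simp
    · rw [← WithTop.coe_untop₀_of_ne_top htop] at hle
      have hle' := WithTop.coe_le_coe.1 hle
      push_cast
      linarith

lemma logCounting_eulerSum_le {f : ℂ → ℂ} (hf : Meromorphic f)
    (hf0 : ∀ z, meromorphicOrderAt f z ≠ ⊤) {j : ℕ} {κ r : ℝ} (hκ : κ ≠ 0)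
    (hr : 1 ≤ r)
    (h0 : meromorphicOrderAt (eulerSum j κ f) 0 = meromorphicOrderAt f 0) :
    logCounting (eulerSum j κ f) ⊤ r ≤ (j + 1) * logCounting f ⊤ r := by
  have := locallyFinsuppWithin.logCounting_le (negPart_divisor_eulerSum_le hf hf0 hκ h0) hr
  rw [map_nsmul, ← logCounting_top, ← logCounting_top, Pi.smul_apply, nsmul_eq_mul] at this
  exact_mod_cast this

/-! ### Circle averages of logarithmic derivatives -/

lemma Meromorphic.mul_logDeriv_div {g : ℂ → ℂ} (hg : Meromorphic g) (κ : ℝ) :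
    Meromorphic fun z ↦ z * logDeriv g z / (κ : ℂ) :=
  Meromorphic.div (Meromorphic.mul (fun _ ↦ by fun_prop) (hg.deriv.div hg)) (Meromorphic.const _)

lemma circleAverage_log_one_add_logDeriv_le {g : ℂ → ℂ} (hg : Meromorphic g)
    (hg' : ∀ z, meromorphicOrderAt g z ≠ ⊤) {r ρ κ B : ℝ} (hr : 3 ≤ r) (hrρ : r < ρ) (hκ : 0 < κ)
    (hB : 1 ≤ B)
    (hgB : 4.1 * (ρ / (ρ - r)) * (characteristic g ⊤ ρ + characteristic g⁻¹ ⊤ ρ) ≤ κ * B) :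
    circleAverage (fun z ↦ log (1 + ‖z * logDeriv g z / (κ : ℂ)‖)) 0 r
      ≤ log B + 2⁻¹ * log 8 + 1 := by
  obtain ⟨h, M, hh, hM, hle⟩ := exists_isCaratheodory_logDeriv hg hg' hr hrρ
  have := circleAverage_log_one_add_le (by linarith)
    (fun i ↦ (hh i).const_mul (inv_nonneg.2 hκ.le)) hB
    (Y := fun z ↦ ‖z * logDeriv g z / (κ : ℂ)‖) ?_ (fun _ ↦ norm_nonneg _)
    ((hg.mul_logDeriv_div κ).circleIntegrable_log_one_add_norm r) ?_
  · simpa [show (7 : ℝ) + 1 = 8 by norm_num] using this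
  · rw [← Finset.mul_sum, inv_mul_le_iff₀ hκ]
    linarith
  · filter_upwards [hle] with z hz
    simp only [norm_mul, norm_div, norm_inv, Complex.norm_real, norm_of_nonneg hκ.le,
      Complex.ofReal_inv] at hz ⊢
    rw [← Finset.mul_sum, div_eq_inv_mul]
    exact mul_le_mul_of_nonneg_left hz (inv_nonneg.2 hκ.le)

lemma circleAverage_log_one_add_logDeriv_add_logDeriv_le {g₁ g₂ : ℂ → ℂ} (hg₁ : Meromorphic g₁)
    (hg₁' : ∀ z, meromorphicOrderAt g₁ z ≠ ⊤) (hg₂ : Meromorphic g₂)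
    (hg₂' : ∀ z, meromorphicOrderAt g₂ z ≠ ⊤) {r ρ₁ ρ₂ κ B₁ B₂ : ℝ} (hr : 3 ≤ r) (hrρ₁ : r < ρ₁)
    (hrρ₂ : r < ρ₂) (hκ : 0 < κ) (hB : 1 ≤ B₁ + B₂)
    (hgB₁ : 4.1 * (ρ₁ / (ρ₁ - r)) * (characteristic g₁ ⊤ ρ₁ + characteristic g₁⁻¹ ⊤ ρ₁) ≤ κ * B₁)
    (hgB₂ : 4.1 * (ρ₂ / (ρ₂ - r)) * (characteristic g₂ ⊤ ρ₂ + characteristic g₂⁻¹ ⊤ ρ₂) ≤ κ * B₂) :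
    circleAverage (fun z ↦ log (1 + (‖z * logDeriv g₁ z / (κ : ℂ)‖
      + ‖z * logDeriv g₂ z / (κ : ℂ)‖))) 0 r ≤ log (B₁ + B₂) + 2⁻¹ * log 15 + 1 := by
  obtain ⟨h₁, M₁, hh₁, hM₁, hle₁⟩ := exists_isCaratheodory_logDeriv hg₁ hg₁' hr hrρ₁
  obtain ⟨h₂, M₂, hh₂, hM₂, hle₂⟩ := exists_isCaratheodory_logDeriv hg₂ hg₂' hr hrρ₂
  have H : ∀ i : Fin 7 ⊕ Fin 7, IsCaratheodory r (Sum.elim h₁ h₂ i) (Sum.elim M₁ M₂ i) := by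
    rintro (i | i)
    · exact hh₁ i
    · exact hh₂ i
  have := circleAverage_log_one_add_le (by linarith)
    (fun i ↦ (H i).const_mul (inv_nonneg.2 hκ.le)) hB
    (Y := fun z ↦ ‖z * logDeriv g₁ z / (κ : ℂ)‖ + ‖z * logDeriv g₂ z / (κ : ℂ)‖) ?_
    (fun _ ↦ by positivity)
    ((hg₁.mul_logDeriv_div κ).circleIntegrable_log_one_add_norm_add_norm
      (hg₂.mul_logDeriv_div κ) r) ?_
  · simpa [show (14 : ℝ) + 1 = 15 by norm_num] using this
  · rw [← Finset.mul_sum, inv_mul_le_iff₀ hκ, Fintype.sum_sum_type]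
    simp only [Sum.elim_inl, Sum.elim_inr]
    linarith
  · filter_upwards [hle₁, hle₂] with z hz₁ hz₂
    simp only [norm_mul, norm_div, norm_inv, Complex.norm_real, norm_of_nonneg hκ.le,
      Complex.ofReal_inv] at hz₁ hz₂ ⊢
    rw [← Finset.mul_sum, Fintype.sum_sum_type, div_eq_inv_mul, div_eq_inv_mul, ← mul_add]
    simp only [Sum.elim_inl, Sum.elim_inr]
    exact mul_le_mul_of_nonneg_left (add_le_add hz₁ hz₂) (inv_nonneg.2 hκ.le)

/-! ### Higher derivatives -/

/-- The function `z ^ j * f⁽ʲ⁾ / (κ ^ j * f)`, the normalized higher logarithmic derivative. -/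
noncomputable def eulerRatio (j : ℕ) (κ : ℝ) (f : ℂ → ℂ) (z : ℂ) : ℂ :=
  eulerDeriv j f z / (f z * (κ : ℂ) ^ j)

lemma Meromorphic.eulerRatio {f : ℂ → ℂ} (hf : Meromorphic f) (j : ℕ) (κ : ℝ) :
    Meromorphic (eulerRatio j κ f) :=
  (hf.eulerDeriv j).div (hf.mul (Meromorphic.const _))

/-- With `F = eulerSum j κ f`, the identity
`eulerRatio (j + 1) κ f = ((eulerRatio j κ f + 1) * (z F' / F) - j * eulerRatio j κ f - z f' / f) / κ`
bounds each normalized derivative by the preceding one and two first-order logarithmic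
derivatives. -/
lemma one_add_norm_eulerRatio_succ_le {f : ℂ → ℂ} {z : ℂ} (hf : AnalyticAt ℂ f z) (hfz : f z ≠ 0)
    {j : ℕ} {κ : ℝ} (hκ : 0 < κ) (hF : eulerSum j κ f z ≠ 0) :
    1 + ‖eulerRatio (j + 1) κ f z‖ ≤ (1 + ‖eulerRatio j κ f z‖) * (1 + j / κ) *
      (1 + (‖z * logDeriv (eulerSum j κ f) z / (κ : ℂ)‖ + ‖z * logDeriv f z / (κ : ℂ)‖)) := by
  have hκc : (κ : ℂ) ≠ 0 := by exact_mod_cast hκ.ne'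
  have hd : DifferentiableAt ℂ (eulerDeriv j f) z := by
    have h1 : DifferentiableAt ℂ (iteratedDeriv j f) z := by
      rw [iteratedDeriv_eq_iterate]
      exact (hf.iterated_deriv j).differentiableAt
    exact DifferentiableAt.fun_mul (by fun_prop) h1
  have hderiv : z * deriv (eulerSum j κ f) z
      = (j * eulerDeriv j f z + eulerDeriv (j + 1) f z) / (κ : ℂ) ^ j + z * deriv f z := by
    have h1 : deriv (eulerSum j κ f) z = deriv (eulerDeriv j f) z / (κ : ℂ) ^ j + deriv f z :=
      ((hd.hasDerivAt.div_const _).add hf.differentiableAt.hasDerivAt).deriv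
    rw [h1, ← mul_deriv_eulerDeriv hf]
    ring
  have hsum : eulerSum j κ f z = f z * (eulerRatio j κ f z + 1) := by
    rw [eulerSum, eulerRatio]
    field_simp
  have hu1 : eulerRatio j κ f z + 1 ≠ 0 := fun h ↦ hF (by rw [hsum, h, mul_zero])
  have hid : eulerRatio (j + 1) κ f z
      = (eulerRatio j κ f z + 1) * (z * logDeriv (eulerSum j κ f) z / (κ : ℂ))
        - (j / κ : ℝ) * eulerRatio j κ f z - z * logDeriv f z / (κ : ℂ) := by
    have h2 : (eulerRatio j κ f z + 1) * (z * logDeriv (eulerSum j κ f) z / (κ : ℂ))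
        = (z * deriv (eulerSum j κ f) z) / f z / κ := by
      rw [logDeriv_apply, hsum]
      field_simp
    rw [h2, hderiv, logDeriv_apply, eulerRatio, eulerRatio]
    push_cast
    field_simp
    ring
  set a := ‖eulerRatio j κ f z‖
  set y := ‖z * logDeriv (eulerSum j κ f) z / (κ : ℂ)‖
  set y' := ‖z * logDeriv f z / (κ : ℂ)‖
  have hq : 0 ≤ j / κ := by positivity
  have hle : ‖eulerRatio (j + 1) κ f z‖ ≤ (a + 1) * y + j / κ * a + y' := by
    rw [hid]
    refine (norm_sub_le _ _).trans (add_le_add ((norm_sub_le _ _).trans (add_le_add ?_ ?_)) le_rfl)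
    · rw [norm_mul]
      gcongr
      exact (norm_add_le _ _).trans (by simp [a])
    · rw [norm_mul, Complex.norm_real, norm_of_nonneg hq]
  have ha : 0 ≤ a := norm_nonneg _
  have hy : 0 ≤ y := norm_nonneg _
  have hy' : 0 ≤ y' := norm_nonneg _
  have e1 := mul_nonneg ha hy'
  have e2 := mul_nonneg hq (mul_nonneg (add_nonneg zero_le_one ha) (add_nonneg hy hy'))
  nlinarith

lemma circleAverage_eulerRatio_succ_le {f : ℂ → ℂ} (hf : Meromorphic f)
    (hf0 : ∀ z, meromorphicOrderAt f z ≠ ⊤) {j : ℕ} {κ r : ℝ} (hκ : 0 < κ) (hr : 0 < r)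
    (hF : ∀ z, meromorphicOrderAt (eulerSum j κ f) z ≠ ⊤) :
    circleAverage (fun z ↦ log (1 + ‖eulerRatio (j + 1) κ f z‖)) 0 r
      ≤ circleAverage (fun z ↦ log (1 + ‖eulerRatio j κ f z‖)) 0 r + j / κ +
        circleAverage (fun z ↦ log (1 + (‖z * logDeriv (eulerSum j κ f) z / (κ : ℂ)‖
          + ‖z * logDeriv f z / (κ : ℂ)‖))) 0 r := by
  have hi₁ := (hf.eulerRatio j κ).circleIntegrable_log_one_add_norm r
  have hi₂ := ((hf.eulerSum j κ).mul_logDeriv_div κ).circleIntegrable_log_one_add_norm_add_norm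
    (hf.mul_logDeriv_div κ) r
  have hc : CircleIntegrable (fun _ ↦ (j / κ : ℝ)) (0 : ℂ) r := circleIntegrable_const _ _ _
  have hi₁c : CircleIntegrable (fun z ↦ log (1 + ‖eulerRatio j κ f z‖) + j / κ) 0 r := hi₁.add hc
  rw [← circleAverage_const (j / κ : ℝ) (0 : ℂ) r, ← circleAverage_fun_add hi₁ hc,
    ← circleAverage_fun_add hi₁c hi₂]
  refine circleAverage_mono_codiscreteWithin hr.ne'
    ((hf.eulerRatio (j + 1) κ).circleIntegrable_log_one_add_norm r) (hi₁c.add hi₂) ?_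
  have hsub : codiscreteWithin (sphere (0 : ℂ) |r|) ≤ codiscreteWithin univ :=
    codiscreteWithin_mono (subset_univ _)
  filter_upwards [hsub (meromorphicOn_univ.2 hf).analyticAt_mem_codiscreteWithin,
    ((meromorphicOn_univ.2 hf).eventually_codiscreteWithin_apply_ne_zero
      fun z _ ↦ hf0 z).filter_mono hsub,
    ((meromorphicOn_univ.2 (hf.eulerSum j κ)).eventually_codiscreteWithin_apply_ne_zero
      fun z _ ↦ hF z).filter_mono hsub] with z h1 h2 h3
  have h4 := one_add_norm_eulerRatio_succ_le h1 h2 hκ h3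
  have hq : 0 ≤ j / κ := by positivity
  refine (log_le_log (by positivity) h4).trans ?_
  rw [log_mul (by positivity) (by positivity), log_mul (by positivity) (by positivity)]
  have := log_le_sub_one_of_pos (show 0 < 1 + j / κ by positivity)
  linarith

/-- The scale `T(ρ, f) * ρ / (ρ - r)` on the circle of radius `r`. -/
noncomputable def growthScale (f : ℂ → ℂ) (r ρ : ℝ) : ℝ := characteristic f ⊤ ρ * (ρ / (ρ - r))

lemma characteristic_le_growthScale (f : ℂ → ℂ) {r ρ : ℝ} (hr : 1 ≤ r) (hrρ : r < ρ) :
    characteristic f ⊤ ρ ≤ growthScale f r ρ := by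
  refine le_mul_of_one_le_right (characteristic_nonneg (by linarith)) ?_
  rw [one_le_div (by linarith)]
  linarith

/-- Moving the inner radius three quarters of the way to `ρ` multiplies the scale by four. -/
lemma growthScale_sub_div (f : ℂ → ℂ) (r ρ : ℝ) :
    growthScale f (ρ - (ρ - r) / 4) ρ = 4 * growthScale f r ρ := by
  rw [growthScale, growthScale, sub_sub_cancel, div_div_eq_mul_div]
  ring

/-- The factor `4` relates the scale of the circles of radii `r` and `ρ - (ρ - r) / 4`; see
`growthScale_sub_div`. -/
lemma proximity_eulerSum_le {f : ℂ → ℂ} (hf : Meromorphic f)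
    (hf0 : ∀ z, meromorphicOrderAt f z ≠ ⊤) {j : ℕ} {κ r : ℝ} (hκ : 0 < κ) (hr : 0 < r) :
    proximity (eulerSum j κ f) ⊤ r ≤ proximity f ⊤ r + j * log 4
      + circleAverage (fun z ↦ log (1 + ‖eulerRatio j (4 * κ) f z‖)) 0 r := by
  have hi₁ : CircleIntegrable (fun z ↦ log⁺ ‖f z‖) 0 r :=
    hf.meromorphicOn.circleIntegrable_posLog_norm
  have hi₂ := (hf.eulerRatio j (4 * κ)).circleIntegrable_log_one_add_norm r
  have hc : CircleIntegrable (fun _ ↦ (j * log 4 : ℝ)) (0 : ℂ) r := circleIntegrable_const _ _ _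
  have hi₁c : CircleIntegrable (fun z ↦ log⁺ ‖f z‖ + j * log 4) 0 r := hi₁.add hc
  rw [proximity_top, proximity_top, ← circleAverage_const (j * log 4 : ℝ) (0 : ℂ) r,
    ← circleAverage_fun_add hi₁ hc, ← circleAverage_fun_add hi₁c hi₂]
  refine circleAverage_mono_codiscreteWithin hr.ne'
    (hf.eulerSum j κ).meromorphicOn.circleIntegrable_posLog_norm (hi₁c.add hi₂) ?_
  have hsub : codiscreteWithin (sphere (0 : ℂ) |r|) ≤ codiscreteWithin univ :=
    codiscreteWithin_mono (subset_univ _)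
  filter_upwards [((meromorphicOn_univ.2 hf).eventually_codiscreteWithin_apply_ne_zero
      fun z _ ↦ hf0 z).filter_mono hsub] with z hz
  have hκc : (κ : ℂ) ≠ 0 := by exact_mod_cast hκ.ne'
  have hsum : eulerSum j κ f z = f z * (4 ^ j * eulerRatio j (4 * κ) f z + 1) := by
    rw [eulerSum, eulerRatio]
    push_cast
    rw [mul_pow]
    field_simp
  have hone : (1 : ℝ) ≤ 4 ^ j := one_le_pow₀ (by norm_num)
  have hle : ‖(4 : ℂ) ^ j * eulerRatio j (4 * κ) f z + 1‖
      ≤ 4 ^ j * (1 + ‖eulerRatio j (4 * κ) f z‖) := by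
    refine (norm_add_le _ _).trans ?_
    rw [norm_mul, norm_pow, norm_one, Complex.norm_ofNat]
    linarith
  rw [hsum, norm_mul]
  refine posLog_mul.trans ?_
  have h1 := posLog_le_posLog (norm_nonneg _) hle
  have h2 : log⁺ ((4 : ℝ) ^ j * (1 + ‖eulerRatio j (4 * κ) f z‖))
      = j * log 4 + log (1 + ‖eulerRatio j (4 * κ) f z‖) := by
    have h3 : 1 ≤ 1 + ‖eulerRatio j (4 * κ) f z‖ := by
      linarith [norm_nonneg (eulerRatio j (4 * κ) f z)]
    rw [posLog_eq_log, log_mul (by positivity) (by positivity), log_pow]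
    rw [abs_of_nonneg (by positivity)]
    exact one_le_mul_of_one_le_of_one_le hone h3
  linarith

lemma log_add_half_log_fifteen_le : log 15.1 + 2⁻¹ * log 15 ≤ 4.2 := by
  have h1 : log 15.1 + 2⁻¹ * log 15 = 2⁻¹ * log (15.1 ^ 2 * 15) := by
    rw [log_mul (by norm_num) (by norm_num), log_pow]
    push_cast
    ring
  have h2 : log (15.1 ^ 2 * 15) ≤ 8.4 := by
    rw [log_le_iff_le_exp (by norm_num), show (8.4 : ℝ) = 8 + 0.4 by norm_num, exp_add,
      show (8 : ℝ) = (8 : ℕ) * 1 by norm_num, exp_nat_mul]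
    have h3 : (2.718 : ℝ) ^ 8 ≤ exp 1 ^ 8 := pow_le_pow_left₀ (by norm_num)
      (by linarith [exp_one_gt_d9]) 8
    have h4 : (1.4 : ℝ) ≤ exp 0.4 := by linarith [add_one_le_exp (0.4 : ℝ)]
    calc (15.1 ^ 2 * 15 : ℝ) ≤ 2.718 ^ 8 * 1.4 := by norm_num
      _ ≤ _ := mul_le_mul h3 h4 (by norm_num) (by positivity)
  linarith

lemma log_add_half_log_eight_le : log 8.3 + 2⁻¹ * log 8 + 1 ≤ 5.3078 := by
  have h1 : log 8.3 ≤ log 15.1 := log_le_log (by norm_num) (by norm_num)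
  have h2 : log 8 ≤ log 15 := log_le_log (by norm_num) (by norm_num)
  linarith [log_add_half_log_fifteen_le]

lemma exists_circleAverage_eulerRatio_one_le {f : ℂ → ℂ} (hf : Meromorphic f)
    (hf0 : ∀ z, meromorphicOrderAt f z ≠ ⊤) (hT : Tendsto (characteristic f ⊤) atTop atTop) :
    ∃ r₀ : ℝ, ∀ r ρ, r₀ < r → r < ρ →
      circleAverage (fun z ↦ log (1 + ‖eulerRatio 1 (growthScale f r ρ) f z‖)) 0 r ≤ 5.3078 := by
  set c := log ‖meromorphicTrailingCoeffAt f 0‖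
  obtain ⟨R, hR⟩ := eventually_atTop.1 (hT.eventually_ge_atTop (max 1 (41 * |c|)))
  refine ⟨max 3 R, fun r ρ hr hrρ ↦ ?_⟩
  have hr3 : 3 < r := (le_max_left _ _).trans_lt hr
  have hTρ := hR ρ (((le_max_right _ _).trans_lt hr).le.trans hrρ.le)
  have hT1 : 1 ≤ characteristic f ⊤ ρ := (le_max_left _ _).trans hTρ
  have hT2 : 41 * |c| ≤ characteristic f ⊤ ρ := (le_max_right _ _).trans hTρ
  have hinv := characteristic_sub_characteristic_inv_of_ne_zero hf (R := ρ) (by linarith)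
  have hκT := characteristic_le_growthScale f (by linarith) hrρ
  have hq : 0 ≤ ρ / (ρ - r) := div_nonneg (by linarith) (by linarith)
  have hmain := circleAverage_log_one_add_logDeriv_le hf hf0 hr3.le hrρ
    (κ := growthScale f r ρ) (B := 8.3) (by linarith) (by norm_num) (by
      rw [growthScale]
      have h1 : characteristic f⁻¹ ⊤ ρ ≤ characteristic f ⊤ ρ + |c| := by
        linarith [neg_abs_le c]
      have h2 : 4.1 * (characteristic f ⊤ ρ + characteristic f⁻¹ ⊤ ρ)
          ≤ 8.3 * characteristic f ⊤ ρ := by linarith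
      have h3 := mul_le_mul_of_nonneg_left h2 hq
      linarith)
  have heq : eulerRatio 1 (growthScale f r ρ) f
      = fun z ↦ z * logDeriv f z / ((growthScale f r ρ : ℝ) : ℂ) := by
    ext z
    simp only [eulerRatio, eulerDeriv, iteratedDeriv_one, pow_one, logDeriv_apply]
    ring
  rw [heq]
  exact hmain.trans log_add_half_log_eight_le

/-- Passing from the order `j` to the order `j + 1` costs the logarithmic mean of
`z F' / F` and `z f' / f` with `F = eulerSum j κ f`. The hypothesis on the order `j` is used twice: on
the circle of radius `r`, and on an intermediate circle of radius `ρ' = ρ - (ρ - r) / 4`, where it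
shows that the characteristic of `F` is at most `(j + 1) T(ρ, f)` up to a bounded term. Bounded terms
are absorbed by the growth of `T(ρ, f)`. -/
lemma exists_circleAverage_eulerRatio_succ_le {f : ℂ → ℂ} (hf : Meromorphic f)
    (hf0 : ∀ z, meromorphicOrderAt f z ≠ ⊤) (hT : Tendsto (characteristic f ⊤) atTop atTop)
    {j : ℕ} (hj : 1 ≤ j) {C : ℝ} (hC : ∃ r₀ : ℝ, ∀ r ρ, r₀ < r → r < ρ →
      circleAverage (fun z ↦ log (1 + ‖eulerRatio j (growthScale f r ρ) f z‖)) 0 r ≤ C) :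
    ∃ r₀ : ℝ, ∀ r ρ, r₀ < r → r < ρ →
      circleAverage (fun z ↦ log (1 + ‖eulerRatio (j + 1) (growthScale f r ρ) f z‖)) 0 r
        ≤ C + log (j + 1) + 5.3078 := by
  obtain ⟨r₁, hr₁⟩ := hC
  obtain ⟨K, hK⟩ := exists_forall_le_eulerSum_order hf (hf0 0) hj
  set b := meromorphicTrailingCoeffAt f 0
  have hb0 : 0 < ‖b‖ := norm_pos_iff.2 ((hf 0).meromorphicTrailingCoeffAt_ne_zero (hf0 0))
  set c := log ‖b‖
  -- everything that does not grow with `ρ` is collected in `A`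
  set A := 2 * (j * log 4 + |C|) + |log (‖b‖ / 2)| + |c| with hA
  obtain ⟨R, hR⟩ := eventually_atTop.1
    (hT.eventually_ge_atTop (max (max K (10 * j)) (max 1 (1000 * A))))
  refine ⟨max (max 3 R) r₁, fun r ρ hr hrρ ↦ ?_⟩
  have hr3 : 3 < r := (le_max_left _ _).trans_lt ((le_max_left _ _).trans_lt hr)
  have hrR : R < r := (le_max_right _ _).trans_lt ((le_max_left _ _).trans_lt hr)
  have hrr₁ : r₁ < r := (le_max_right _ _).trans_lt hr
  have hTρ := hR ρ (hrR.trans hrρ).le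
  have hTK : K ≤ characteristic f ⊤ ρ := (le_max_left _ _).trans ((le_max_left _ _).trans hTρ)
  have hTj : 10 * j ≤ characteristic f ⊤ ρ := (le_max_right _ _).trans ((le_max_left _ _).trans hTρ)
  have hT1 : 1 ≤ characteristic f ⊤ ρ := (le_max_left _ _).trans ((le_max_right _ _).trans hTρ)
  have hTA : 1000 * A ≤ characteristic f ⊤ ρ :=
    (le_max_right _ _).trans ((le_max_right _ _).trans hTρ)
  set T := characteristic f ⊤ ρ
  set κ := growthScale f r ρ with hκdef
  have hκT : T ≤ κ := characteristic_le_growthScale f (by linarith) hrρ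
  have hκ : 0 < κ := by linarith
  set ρ' := ρ - (ρ - r) / 4 with hρ'
  have hrρ' : r < ρ' := by linarith
  have hρρ' : ρ' < ρ := by linarith
  obtain ⟨hord, htrail⟩ := hK κ (hTK.trans hκT)
  set F := eulerSum j κ f
  have hFmer : Meromorphic F := hf.eulerSum j κ
  have hF0 : ∀ z, meromorphicOrderAt F z ≠ ⊤ :=
    hFmer.exists_meromorphicOrderAt_ne_top_iff_forall.1 ⟨0, by rw [hord]; exact hf0 0⟩
  have hmono : characteristic f ⊤ ρ' ≤ T :=
    characteristic_monotoneOn hf (mem_Ioi.2 (by linarith)) (mem_Ioi.2 (by linarith)) hρρ'.le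
  have hTF : characteristic F ⊤ ρ' ≤ (j + 1) * T + (j * log 4 + C) := by
    have h1 := proximity_eulerSum_le hf hf0 (j := j) hκ (show 0 < ρ' by linarith)
    rw [hκdef, ← growthScale_sub_div, ← hκdef] at h1
    have h2 := hr₁ ρ' ρ (hrr₁.trans hrρ') hρρ'
    have h3 := logCounting_eulerSum_le hf hf0 hκ.ne' (show 1 ≤ ρ' by linarith) hord
    have h4 : proximity f ⊤ ρ' + logCounting f ⊤ ρ' ≤ T := hmono
    have h5 : (0 : ℝ) ≤ proximity f ⊤ ρ' := proximity_nonneg ρ'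
    have h6 : characteristic F ⊤ ρ' = proximity F ⊤ ρ' + logCounting F ⊤ ρ' := rfl
    have h7 := mul_le_mul_of_nonneg_left h4 (show (0 : ℝ) ≤ j by positivity)
    have h8 := mul_nonneg (show (0 : ℝ) ≤ j by positivity) h5
    rw [h6]
    linarith
  have hTF' : characteristic F⁻¹ ⊤ ρ' ≤ characteristic F ⊤ ρ' + |log (‖b‖ / 2)| := by
    have h1 := characteristic_sub_characteristic_inv_of_ne_zero hFmer (R := ρ') (by linarith)
    have h2 := log_le_log (by positivity) htrail
    linarith [neg_abs_le (log (‖b‖ / 2))]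
  have hinv : characteristic f⁻¹ ⊤ ρ ≤ T + |c| := by
    have h1 := characteristic_sub_characteristic_inv_of_ne_zero hf (R := ρ) (by linarith)
    linarith [neg_abs_le c]
  have hq : 0 ≤ ρ / (ρ - r) := div_nonneg (by linarith) (by linarith)
  have hq' : ρ' / (ρ' - r) ≤ 4 / 3 * (ρ / (ρ - r)) := by
    have h1 : ρ' - r = 3 / 4 * (ρ - r) := by rw [hρ']; ring
    rw [h1, div_mul_div_comm, div_le_div_iff₀ (by linarith) (by linarith)]
    nlinarith
  have hlog4 : 0 ≤ j * log 4 := mul_nonneg (by positivity) (log_nonneg (by norm_num))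
  have hCA := le_abs_self C
  have hj' : (1 : ℝ) ≤ j := by exact_mod_cast hj
  -- `10.94` exceeds `4.1 * (4 / 3) * 2`, and `4.16 * (j + 1)` exceeds `4.1 * 2` as `1 ≤ j`
  have hlogd := circleAverage_log_one_add_logDeriv_add_logDeriv_le hFmer hF0 hf hf0 hr3.le hrρ' hrρ
    hκ (B₁ := 10.94 * (j + 1)) (B₂ := 4.16 * (j + 1)) (by linarith) ?_ ?_
  · have h1 := circleAverage_eulerRatio_succ_le hf hf0 (j := j) hκ (show 0 < r by linarith) hF0
    have h2 := hr₁ r ρ hrr₁ hrρ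
    have h3 : j / κ ≤ 0.1 := by
      rw [div_le_iff₀ hκ]
      linarith
    rw [show 10.94 * ((j : ℝ) + 1) + 4.16 * (j + 1) = 15.1 * (j + 1) by ring,
      log_mul (by norm_num) (by positivity)] at hlogd
    linarith [log_add_half_log_fifteen_le]
  · have h1 : characteristic F ⊤ ρ' + characteristic F⁻¹ ⊤ ρ' ≤ (2 * (j + 1) + 0.001) * T := by
      linarith [abs_nonneg c]
    have h2 : 0 ≤ characteristic F ⊤ ρ' + characteristic F⁻¹ ⊤ ρ' :=
      add_nonneg (characteristic_nonneg (by linarith)) (characteristic_nonneg (by linarith))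
    calc 4.1 * (ρ' / (ρ' - r)) * (characteristic F ⊤ ρ' + characteristic F⁻¹ ⊤ ρ')
        ≤ 4.1 * (4 / 3 * (ρ / (ρ - r))) * ((2 * (j + 1) + 0.001) * T) :=
          mul_le_mul (mul_le_mul_of_nonneg_left hq' (by norm_num)) h1 h2 (by positivity)
      _ = κ * (4.1 * (4 / 3) * (2 * (j + 1) + 0.001)) := by
          rw [hκdef, growthScale]
          ring
      _ ≤ _ := mul_le_mul_of_nonneg_left (by linarith) hκ.le
  · have h1 : characteristic f ⊤ ρ + characteristic f⁻¹ ⊤ ρ ≤ 2.001 * T := by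
      linarith [abs_nonneg (log (‖b‖ / 2)), abs_nonneg C]
    calc 4.1 * (ρ / (ρ - r)) * (characteristic f ⊤ ρ + characteristic f⁻¹ ⊤ ρ)
        ≤ 4.1 * (ρ / (ρ - r)) * (2.001 * T) :=
          mul_le_mul_of_nonneg_left h1 (by positivity)
      _ = κ * (4.1 * 2.001) := by
          rw [hκdef, growthScale]
          ring
      _ ≤ _ := mul_le_mul_of_nonneg_left (by linarith) hκ.le

/-- The normalized `j`-th logarithmic derivative has logarithmic mean at most `5.3078 j + log j!`. -/
theorem exists_circleAverage_eulerRatio_le {f : ℂ → ℂ} (hf : Meromorphic f)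
    (hf0 : ∀ z, meromorphicOrderAt f z ≠ ⊤) (hT : Tendsto (characteristic f ⊤) atTop atTop)
    {j : ℕ} (hj : 1 ≤ j) : ∃ r₀ : ℝ, ∀ r ρ, r₀ < r → r < ρ →
      circleAverage (fun z ↦ log (1 + ‖eulerRatio j (growthScale f r ρ) f z‖)) 0 r
        ≤ 5.3078 * j + log (j.factorial : ℝ) := by
  induction j, hj using Nat.le_induction with
  | base => simpa using exists_circleAverage_eulerRatio_one_le hf hf0 hT
  | succ j hj ih =>
    have h := exists_circleAverage_eulerRatio_succ_le hf hf0 hT hj ih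
    refine h.imp fun r₀ h r ρ hr hrρ ↦ (h r ρ hr hrρ).trans (le_of_eq ?_)
    rw [Nat.factorial_succ]
    push_cast
    rw [log_mul (by positivity) (by positivity)]
    ring

/-- A quantitative lemma on the logarithmic derivative for higher derivatives. -/
theorem exists_proximity_iteratedDeriv_div_le {f : ℂ → ℂ} (hf : Meromorphic f)
    (hf0 : ∀ z, meromorphicOrderAt f z ≠ ⊤) (hT : Tendsto (characteristic f ⊤) atTop atTop)
    (j : ℕ) : ∃ r₀ : ℝ, ∀ r ρ, r₀ < r → r < ρ →
      proximity (iteratedDeriv j f / f) ⊤ r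
        ≤ j * (log⁺ (characteristic f ⊤ ρ / r * (ρ / (ρ - r))) + 5.3078)
          + log (j.factorial : ℝ) := by
  have hdiv : Meromorphic (iteratedDeriv j f / f) := (hf.iteratedDeriv j).div hf
  rcases Nat.eq_zero_or_pos j with rfl | hj
  · refine ⟨0, fun r ρ hr hrρ ↦ ?_⟩
    rw [proximity_top]
    simp only [CharP.cast_eq_zero, zero_mul, Nat.factorial_zero, Nat.cast_one, log_one, add_zero]
    have hi := hdiv.meromorphicOn.circleIntegrable_posLog_norm (c := 0) (R := r)
    refine circleAverage_mono_on_of_le_circle hi fun z _ ↦ ?_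
    rw [iteratedDeriv_zero, Pi.div_apply]
    rcases eq_or_ne (f z) 0 with h | h
    · simp [h]
    · simp [div_self h]
  · obtain ⟨r₀, h⟩ := exists_circleAverage_eulerRatio_le hf hf0 hT hj
    obtain ⟨R, hR⟩ := eventually_atTop.1 (hT.eventually_ge_atTop 1)
    refine ⟨max (max r₀ R) 1, fun r ρ hr hrρ ↦ ?_⟩
    have hr1 : 1 < r := (le_max_right _ _).trans_lt hr
    have hrr₀ : r₀ < r := (le_max_left _ _).trans_lt ((le_max_left _ _).trans_lt hr)
    have hrR : R < r := (le_max_right _ _).trans_lt ((le_max_left _ _).trans_lt hr)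
    have hκ : 1 ≤ growthScale f r ρ :=
      (hR ρ (hrR.trans hrρ).le).trans (characteristic_le_growthScale f hr1.le hrρ)
    have hmain := h r ρ hrr₀ hrρ
    have hX : characteristic f ⊤ ρ / r * (ρ / (ρ - r)) = growthScale f r ρ / r := by
      rw [growthScale]
      ring
    rw [hX]
    set κ := growthScale f r ρ
    have hi := (hf.eulerRatio j κ).circleIntegrable_log_one_add_norm r
    have hc : CircleIntegrable (fun _ ↦ (j * log⁺ (κ / r) : ℝ)) (0 : ℂ) r :=
      circleIntegrable_const _ _ _
    have hle : proximity (iteratedDeriv j f / f) ⊤ r ≤ j * log⁺ (κ / r)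
        + circleAverage (fun z ↦ log (1 + ‖eulerRatio j κ f z‖)) 0 r := by
      rw [proximity_top, ← circleAverage_const (j * log⁺ (κ / r) : ℝ) (0 : ℂ) r,
        ← circleAverage_fun_add hc hi]
      refine circleAverage_mono hdiv.meromorphicOn.circleIntegrable_posLog_norm (hc.add hi) ?_
      intro z hz
      have hzr : ‖z‖ = r := by simpa [abs_of_pos (by linarith : 0 < r)] using hz
      have hz0 : z ≠ 0 := by
        rintro rfl
        rw [norm_zero] at hzr
        linarith
      have hκc : (κ : ℂ) ≠ 0 := by exact_mod_cast (by linarith : κ ≠ 0)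
      have hid : (iteratedDeriv j f / f) z = ((κ : ℂ) / z) ^ j * eulerRatio j κ f z := by
        rw [eulerRatio, eulerDeriv, Pi.div_apply, div_pow]
        field_simp
      rw [hid, norm_mul, norm_pow, norm_div, hzr, Complex.norm_real,
        norm_of_nonneg (by linarith)]
      refine posLog_mul.trans (add_le_add (le_of_eq (posLog_pow _ _)) ?_)
      exact posLog_le_log_one_add (norm_nonneg _)
    linarith

/-! ### Differential polynomials -/

namespace DiffPoly

variable {m : ℕ}

lemma one_le_degree_iff {l : Fin (m + 1) → ℕ} : 1 ≤ degree l ↔ l ≠ 0 := by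
  rw [Nat.one_le_iff_ne_zero, degree, ne_eq, Finset.sum_eq_zero_iff, not_iff_not]
  simp [funext_iff]

lemma filter_one_le_degree (I : Finset (Fin (m + 1) → ℕ)) :
    I.filter (fun l ↦ 1 ≤ degree l) = I.erase 0 := by
  ext l
  simp [one_le_degree_iff, and_comm]

lemma eval_zero (I : Finset (Fin (m + 1) → ℕ)) (a : (Fin (m + 1) → ℕ) → ℂ → ℂ) :
    eval I a 0 = if 0 ∈ I then a 0 else 0 := by
  have hterm : ∀ l : Fin (m + 1) → ℕ, ∀ z : ℂ,
      a l z * ∏ j : Fin (m + 1), iteratedDeriv (j : ℕ) (0 : ℂ → ℂ) z ^ l j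
        = if l = 0 then a l z else 0 := by
    intro l z
    have h0 : ∀ j : Fin (m + 1), iteratedDeriv (j : ℕ) (0 : ℂ → ℂ) z = 0 := by
      intro j
      have : (0 : ℂ → ℂ) = fun _ ↦ 0 := rfl
      rw [this, iteratedDeriv_const]
      simp
    split_ifs with hl
    · simp [hl]
    · obtain ⟨j, hj⟩ := Function.ne_iff.1 hl
      rw [Finset.prod_eq_zero (Finset.mem_univ j) (by rw [h0 j, zero_pow hj]), mul_zero]
  ext z
  simp only [eval, hterm]
  rw [Finset.sum_ite_eq' I 0 fun l ↦ a l z]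
  split_ifs <;> rfl

/-- If a differential polynomial vanishes, dividing by its constant term `c` and by `f` bounds
`1 / f` where `f` is small: every other monomial contains at least one factor `f`. -/
lemma posLog_norm_inv_le (J : Finset (Fin (m + 1) → ℕ)) (hJ : ∀ l ∈ J, 1 ≤ degree l)
    {b : (Fin (m + 1) → ℕ) → ℂ} {c w : ℂ} {d : Fin (m + 1) → ℂ} (hc : c ≠ 0) (hw : w ≠ 0)
    (h : c + ∑ l ∈ J, b l * ∏ j, d j ^ l j = 0) :
    log⁺ ‖w⁻¹‖ ≤ log⁺ ‖c⁻¹‖ + log J.card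
      + ∑ l ∈ J, (log⁺ ‖b l‖ + ∑ j, (l j : ℝ) * log⁺ ‖d j / w‖) := by
  have hlogJ : 0 ≤ log (J.card : ℝ) := log_natCast_nonneg _
  have hterm : ∀ l, 0 ≤ log⁺ ‖b l‖ + ∑ j, (l j : ℝ) * log⁺ ‖d j / w‖ := fun l ↦
    add_nonneg posLog_nonneg (Finset.sum_nonneg fun j _ ↦
      mul_nonneg (Nat.cast_nonneg _) posLog_nonneg)
  rcases le_or_gt 1 ‖w‖ with h1 | h1
  · have h0 : log⁺ ‖w⁻¹‖ = 0 := by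
      rw [posLog_eq_zero_iff, abs_norm, norm_inv]
      exact inv_le_one_of_one_le₀ h1
    rw [h0]
    exact add_nonneg (add_nonneg posLog_nonneg hlogJ) (Finset.sum_nonneg fun l _ ↦ hterm l)
  · have hw0 : 0 < ‖w‖ := norm_pos_iff.2 hw
    have hmono : ∀ l ∈ J, ‖b l * ∏ j, d j ^ l j‖ ≤ ‖w‖ * (‖b l‖ * ∏ j, ‖d j / w‖ ^ l j) := by
      intro l hl
      have h2 : ∏ j, ‖d j‖ ^ l j = ‖w‖ ^ degree l * ∏ j, ‖d j / w‖ ^ l j := by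
        rw [degree, ← Finset.prod_pow_eq_pow_sum, ← Finset.prod_mul_distrib]
        refine Finset.prod_congr rfl fun j _ ↦ ?_
        rw [← mul_pow, norm_div, mul_div_cancel₀ _ hw0.ne']
      have h3 : ‖w‖ ^ degree l ≤ ‖w‖ := pow_le_of_le_one hw0.le h1.le
        (Nat.one_le_iff_ne_zero.1 (hJ l hl))
      rw [norm_mul, norm_prod]
      simp only [norm_pow]
      rw [h2]
      have h4 : 0 ≤ ‖b l‖ * ∏ j, ‖d j / w‖ ^ l j := by positivity
      nlinarith [mul_le_mul_of_nonneg_right h3 h4]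
    have hmain : ‖w⁻¹‖ ≤ ‖c⁻¹‖ * ∑ l ∈ J, ‖b l‖ * ∏ j, ‖d j / w‖ ^ l j := by
      have h2 : ‖c‖ ≤ ‖w‖ * ∑ l ∈ J, ‖b l‖ * ∏ j, ‖d j / w‖ ^ l j := by
        rw [eq_neg_of_add_eq_zero_left h, norm_neg, Finset.mul_sum]
        exact (norm_sum_le _ _).trans (Finset.sum_le_sum hmono)
      have hc0 : 0 < ‖c‖ := norm_pos_iff.2 hc
      rw [norm_inv, norm_inv, inv_mul_eq_div, le_div_iff₀ hc0, inv_mul_le_iff₀ hw0]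
      exact h2
    refine (posLog_le_posLog (norm_nonneg _) hmain).trans ?_
    refine posLog_mul.trans ?_
    rw [add_assoc]
    refine add_le_add le_rfl ((posLog_sum _ _).trans (add_le_add le_rfl ?_))
    refine Finset.sum_le_sum fun l _ ↦ posLog_mul.trans (add_le_add le_rfl ?_)
    refine (posLog_prod _ _).trans (Finset.sum_le_sum fun j _ ↦ ?_)
    rw [posLog_pow]

/-- The integrated form of `posLog_norm_inv_le`. -/
lemma proximity_inv_le (I : Finset (Fin (m + 1) → ℕ)) {a : (Fin (m + 1) → ℕ) → ℂ → ℂ}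
    (ha : ∀ l ∈ I, Meromorphic (a l)) {f : ℂ → ℂ} (hf : Meromorphic f)
    (hf0 : ∀ z, meromorphicOrderAt f z ≠ ⊤) (hPf : eval I a f =ᶠ[codiscrete ℂ] 0) (hI : 0 ∈ I)
    (ha0 : ¬ a 0 =ᶠ[codiscrete ℂ] 0) {r : ℝ} (hr : r ≠ 0) :
    proximity f⁻¹ ⊤ r ≤ proximity (a 0)⁻¹ ⊤ r + log ((I.card : ℝ) - 1)
      + ∑ l ∈ I.erase 0, (proximity (a l) ⊤ r
        + ∑ j : Fin (m + 1), (l j : ℝ) * proximity (iteratedDeriv (j : ℕ) f / f) ⊤ r) := by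
  have hcard : ((I.erase 0).card : ℝ) = I.card - 1 := by
    rw [Finset.card_erase_of_mem hI, Nat.cast_sub (Finset.card_pos.2 ⟨0, hI⟩)]
    simp
  have hi : ∀ {u : ℂ → ℂ}, Meromorphic u → CircleIntegrable (fun z ↦ log⁺ ‖u z‖) 0 r :=
    fun hu ↦ hu.meromorphicOn.circleIntegrable_posLog_norm
  have hd : ∀ j : Fin (m + 1), Meromorphic (iteratedDeriv (j : ℕ) f / f) :=
    fun j ↦ (hf.iteratedDeriv j).div hf
  have hi₁ := hi (ha 0 hI).inv
  have hc : CircleIntegrable (fun _ ↦ log ((I.card : ℝ) - 1)) (0 : ℂ) r :=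
    circleIntegrable_const _ _ _
  have hi₂ : ∀ l : Fin (m + 1) → ℕ, ∀ j ∈ (Finset.univ : Finset (Fin (m + 1))),
      CircleIntegrable (fun z ↦ (l j : ℝ) * log⁺ ‖(iteratedDeriv (j : ℕ) f / f) z‖) 0 r :=
    fun l j _ ↦ (hi (hd j)).const_mul (l j : ℝ)
  have hi₃ : ∀ l : Fin (m + 1) → ℕ,
      CircleIntegrable (fun z ↦ ∑ j, (l j : ℝ) * log⁺ ‖(iteratedDeriv (j : ℕ) f / f) z‖) 0 r := by
    intro l
    simpa only [← Finset.sum_fn] using CircleIntegrable.sum _ (hi₂ l)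
  have hi₄ : ∀ l ∈ I.erase 0, CircleIntegrable (fun z ↦ log⁺ ‖a l z‖
      + ∑ j, (l j : ℝ) * log⁺ ‖(iteratedDeriv (j : ℕ) f / f) z‖) 0 r :=
    fun l hl ↦ (hi (ha l (Finset.mem_of_mem_erase hl))).add (hi₃ l)
  have hi₅ : CircleIntegrable (fun z ↦ ∑ l ∈ I.erase 0, (log⁺ ‖a l z‖
      + ∑ j, (l j : ℝ) * log⁺ ‖(iteratedDeriv (j : ℕ) f / f) z‖)) 0 r := by
    simpa only [← Finset.sum_fn] using CircleIntegrable.sum _ hi₄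
  have hi₁c : CircleIntegrable (fun z ↦ log⁺ ‖(a 0)⁻¹ z‖ + log ((I.card : ℝ) - 1)) 0 r :=
    hi₁.add hc
  have havg : ∑ l ∈ I.erase 0, (proximity (a l) ⊤ r
        + ∑ j : Fin (m + 1), (l j : ℝ) * proximity (iteratedDeriv (j : ℕ) f / f) ⊤ r)
      = circleAverage (fun z ↦ ∑ l ∈ I.erase 0, (log⁺ ‖a l z‖
        + ∑ j, (l j : ℝ) * log⁺ ‖(iteratedDeriv (j : ℕ) f / f) z‖)) 0 r := by
    rw [circleAverage_fun_sum hi₄]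
    refine Finset.sum_congr rfl fun l hl ↦ ?_
    rw [circleAverage_fun_add (hi (ha l (Finset.mem_of_mem_erase hl))) (hi₃ l),
      circleAverage_fun_sum (hi₂ l), proximity_top]
    congr 1
    refine Finset.sum_congr rfl fun j _ ↦ ?_
    rw [proximity_top, ← smul_eq_mul, ← circleAverage_fun_smul]
    rfl
  rw [havg, proximity_top, proximity_top,
    ← circleAverage_const (log ((I.card : ℝ) - 1)) (0 : ℂ) r, ← circleAverage_fun_add hi₁ hc,
    ← circleAverage_fun_add hi₁c hi₅]
  refine circleAverage_mono_codiscreteWithin hr (hi hf.inv) (hi₁c.add hi₅) ?_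
  have hsub : codiscreteWithin (sphere (0 : ℂ) |r|) ≤ codiscreteWithin univ :=
    codiscreteWithin_mono (subset_univ _)
  filter_upwards [hsub hPf, ((meromorphicOn_univ.2 hf).eventually_codiscreteWithin_apply_ne_zero
      fun z _ ↦ hf0 z).filter_mono hsub,
    ((meromorphicOn_univ.2 (ha 0 hI)).eventually_codiscreteWithin_apply_ne_zero
      fun z _ ↦ (ha 0 hI).meromorphicOrderAt_ne_top ha0 z).filter_mono hsub] with z h1 h2 h3
  have h4 : a 0 z + ∑ l ∈ I.erase 0, a l z * ∏ j : Fin (m + 1), iteratedDeriv (j : ℕ) f z ^ l j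
      = 0 := by
    have h5 : eval I a f z = 0 := h1
    rw [eval, ← Finset.add_sum_erase I _ hI] at h5
    simpa using h5
  have h6 := posLog_norm_inv_le (I.erase 0)
    (fun l hl ↦ one_le_degree_iff.2 (Finset.ne_of_mem_erase hl)) h3 h2 h4
  rw [hcard] at h6
  exact h6

end DiffPoly

lemma IsTranscendentalMeromorphic.not_eventuallyEq_const {f : ℂ → ℂ}
    (hf : IsTranscendentalMeromorphic f) (c : ℂ) : ¬ f =ᶠ[codiscrete ℂ] fun _ ↦ c :=
  fun h ↦ hf.2 ⟨Polynomial.C c, 1, one_ne_zero, by simpa using h⟩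

theorem theorem6p2 {m : ℕ} (I : Finset (Fin (m + 1) → ℕ))
    (a : (Fin (m + 1) → ℕ) → ℂ → ℂ) (ha : ∀ l ∈ I, Meromorphic (a l))
    (f : ℂ → ℂ) (hf : IsTranscendentalMeromorphic f)
    (hPf : DiffPoly.eval I a f =ᶠ[Filter.codiscrete ℂ] 0)
    (hP0 : ¬ DiffPoly.eval I a 0 =ᶠ[Filter.codiscrete ℂ] 0) :
    ∃ r₀ : ℝ, 0 < r₀ ∧ ∀ r ρ : ℝ, r₀ < r → r < ρ →
      ValueDistribution.proximity f⁻¹ ⊤ r ≤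
        (∑ l ∈ I, (DiffPoly.weight l : ℝ)) *
            Real.posLog (ValueDistribution.characteristic f ⊤ ρ / r * (ρ / (ρ - r)))
          + ∑ l ∈ I with 1 ≤ DiffPoly.degree l, ValueDistribution.proximity (a l) ⊤ r
          + ValueDistribution.proximity (DiffPoly.eval I a 0)⁻¹ ⊤ r
          + (∑ l ∈ I, (DiffPoly.degree l : ℝ) * Real.log (m.factorial : ℝ))
          + Real.posLog ((I.card : ℝ) - 1)
          + 5.3078 * ∑ l ∈ I, (DiffPoly.weight l : ℝ) := by
  have hfm := hf.1
  have hf0 := hfm.meromorphicOrderAt_ne_top (hf.not_eventuallyEq_const 0)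
  have hT := tendsto_characteristic_atTop hfm hf.not_eventuallyEq_const
  rw [DiffPoly.eval_zero] at hP0 ⊢
  have hI : 0 ∈ I := by
    by_contra h
    simp [h] at hP0
  rw [if_pos hI] at hP0 ⊢
  choose R hR using exists_proximity_iteratedDeriv_div_le hfm hf0 hT
  refine ⟨max 1 (∑ j : Fin (m + 1), |R j|), by positivity, fun r ρ hr hrρ ↦ ?_⟩
  have hr1 : 1 < r := (le_max_left _ _).trans_lt hr
  set Y := log⁺ (characteristic f ⊤ ρ / r * (ρ / (ρ - r))) + 5.3078 with hY
  have hjet : ∀ j : Fin (m + 1), proximity (iteratedDeriv (j : ℕ) f / f) ⊤ r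
      ≤ j * Y + log (m.factorial : ℝ) := by
    intro j
    have h1 : R j < r := (le_abs_self _).trans_lt (((Finset.single_le_sum
      (f := fun j : Fin (m + 1) ↦ |R j|) (fun i _ ↦ abs_nonneg _) (Finset.mem_univ j)).trans
        (le_max_right _ _)).trans_lt hr)
    refine (hR j r ρ h1 hrρ).trans (add_le_add le_rfl ?_)
    exact log_le_log (by positivity) (by exact_mod_cast Nat.factorial_le (Nat.lt_succ_iff.1 j.2))
  have hterm : ∀ l : Fin (m + 1) → ℕ,
      ∑ j : Fin (m + 1), (l j : ℝ) * proximity (iteratedDeriv (j : ℕ) f / f) ⊤ r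
        ≤ DiffPoly.weight l * Y + DiffPoly.degree l * log (m.factorial : ℝ) := by
    intro l
    refine (Finset.sum_le_sum fun j _ ↦
      mul_le_mul_of_nonneg_left (hjet j) (Nat.cast_nonneg (l j))).trans (le_of_eq ?_)
    rw [DiffPoly.weight, DiffPoly.degree]
    push_cast
    rw [Finset.sum_mul, Finset.sum_mul, ← Finset.sum_add_distrib]
    exact Finset.sum_congr rfl fun j _ ↦ by ring
  have hY0 : 0 ≤ Y := add_nonneg posLog_nonneg (by norm_num)
  have hsum : ∑ l ∈ I.erase 0, ∑ j : Fin (m + 1),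
        (l j : ℝ) * proximity (iteratedDeriv (j : ℕ) f / f) ⊤ r
      ≤ (∑ l ∈ I, (DiffPoly.weight l : ℝ)) * Y
        + ∑ l ∈ I, (DiffPoly.degree l : ℝ) * log (m.factorial : ℝ) := by
    rw [Finset.sum_mul, ← Finset.sum_add_distrib]
    refine (Finset.sum_le_sum fun l _ ↦ hterm l).trans
      (Finset.sum_le_sum_of_subset_of_nonneg (Finset.erase_subset _ _) fun l _ _ ↦ ?_)
    exact add_nonneg (mul_nonneg (Nat.cast_nonneg _) hY0)
      (mul_nonneg (Nat.cast_nonneg _) (log_natCast_nonneg _))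
  have hmain := DiffPoly.proximity_inv_le I ha hfm hf0 hPf hI hP0 (show r ≠ 0 by linarith)
  rw [Finset.sum_add_distrib] at hmain
  have hlog : log ((I.card : ℝ) - 1) ≤ log⁺ ((I.card : ℝ) - 1) := le_max_right _ _
  rw [DiffPoly.filter_one_le_degree]
  rw [hY, mul_add] at hsum
  linarith
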